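/- Conventions. Let $\mathbb M$ be a structure in a language $\mathcal L$ which is a monster model: $\mathbb M$ is $\kappa$-saturated and strongly $\kappa$-homogeneous for some cardinal $\kappa>\max(\aleph_0,|\mathcal L|)$. "Definable" means definable with parameters; "small" means of cardinality $<\kappa$; formulas are $\mathcal L$-formulas without parameters unless said otherwise. A (finitary) *matroid* on $\mathbb M$ is an operator $\mathrm{cl}:\mathcal P(\mathbb M)\to\mathcal P(\mathbb M)$ which is extensive, monotone, idempotent, satisfies $\mathrm{cl}(X)=\bigcup\{\mathrm{cl}(A):A\subseteq X\text{ finite}\}$, and satisfies exchange: $a\in \mathrm{cl}(Xc)\setminus \mathrm{cl}(X)$ implies $c\in \mathrm{cl}(Xa)$. A formula $\varphi(x,\bar y)$ is *$x$-narrow* if $\mathbb M\models\varphi(a,\bar b)$ implies $a\in \mathrm{cl}(\bar b)$ for all $a,\bar b$ in $\mathbb M$. The matroid $\mathrm{cl}$ is *existential* if (i) it is definable: for every $A\subseteq\mathbb M$, $\mathrm{cl}(A)$ is the union of the sets $\varphi(\mathbb M,\bar a)$ with $\varphi(x,\bar y)$ $x$-narrow and $\bar a$ a finite tuple from $A$;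 (ii) for every $a\in\mathbb M$ and all small $B,C\subseteq\mathbb M$, if $a\notin \mathrm{cl}(B)$ then there is $a'$ with the same type as $a$ over $B$ and $a'\notin \mathrm{cl}(B\cup C)$; (iii) it is not the operator $X\mapsto\mathbb M$. For a finite tuple $\bar b$ and $A\subseteq \mathbb M$, the rank $\mathrm{rk}^{\mathrm{cl}}(\bar b/A)$ is the largest size of a set $S$ of coordinates of $\bar b$ that is independent over $A$ (i.e. $s\notin\mathrm{cl}(A\cup S\setminus\{s\})$ for all $s\in S$). For $V\subseteq \mathbb M^n$ definable over a small set $A$, the induced dimension is $\dim^{\mathrm{cl}}(V)=\max\{\mathrm{rk}^{\mathrm{cl}}(\bar b/A):\bar b\in V\}$, and $-\infty$ if $V=\emptyset$. The dimension is *definable* if for every definable $X\subseteq\mathbb M^{m}\times\mathbb M^n$ and every $k\in\{-\infty\}\cup\mathbb N$ the set $\{\bar a\in\mathbb M^m:\dim^{\mathrm{cl}}(X_{\bar a})=k\}$ is definable. A *dimension function* on a structure $\mathbb K$ is a function $d$ from the definable subsets of the powers $\mathbb K^m$ ($m\in\mathbb N$) to $\{-\infty\}\cup\mathbb N$ such that,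 for all $m\in\mathbb N$ and definable $S,S_1,S_2\subseteq\mathbb K^m$: (Dim 1) $d(S)=-\infty$ iff $S=\emptyset$; $d(\{a\})=0$ for every $a\in\mathbb K$; $d(\mathbb K)=1$; (Dim 2) $d(S_1\cup S_2)=\max(d(S_1),d(S_2))$; (Dim 3) $d(S^\sigma)=d(S)$ for every permutation $\sigma$ of the coordinates; (Dim 4) if $U\subseteq\mathbb K^{m+1}$ is definable and $U(i)=\{x\in\mathbb K^m:d(U_x)=i\}$ for $i=0,1$, where $U_x=\{t:(x,t)\in U\}$, then $U(i)$ is definable over every parameter set over which $U$ is definable, and $d(U\cap\pi^{-1}(U(i)))=d(U(i))+i$, with $\pi:\mathbb K^{m+1}\to\mathbb K^m$ the projection to the first $m$ coordinates. For such $d$ and $A\subseteq\mathbb K$, let $\mathrm{mat}^d(A)$ be the set of all $b\in\mathbb K$ lying in some $A$-definable $X\subseteq\mathbb K$ with $d(X)=0$. If $\mathbb M$ is an elementary extension of $\mathbb K$, the extension of $\mathrm{mat}^d$ to $\mathbb M$ sends $A\subseteq\mathbb M$ to the union of the sets $\varphi(\mathbb M,\bar a)$, where $\bar a$ is a finite tuple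 from $A$ and $\varphi(x,\bar y)$ is a formula with $d(\varphi(\mathbb K,\bar b))\le 0$ for every tuple $\bar b$ of $\mathbb K$. **Theorem.** (1) Let $d$ be a dimension function on a structure $\mathbb K$, and let $\mathbb M$ be a monster model which is an elementary extension of $\mathbb K$. The extension of $\mathrm{mat}^d$ to $\mathbb M$ does extend $\mathrm{mat}^d$ (for $A\subseteq\mathbb K$, its value at $A$ meets $\mathbb K$ in $\mathrm{mat}^d(A)$), and it is an existential matroid with definable dimension. The dimension it induces is $d$: for every formula $\varphi(\bar x,\bar y)$ and every tuple $\bar b$ of $\mathbb K$, the dimension of $\varphi(\mathbb M^n,\bar b)$ equals $d(\varphi(\mathbb K^n,\bar b))$. (2) Conversely, let $\mathrm{cl}$ be an existential matroid on a monster model $\mathbb M$. Then $\dim^{\mathrm{cl}}(V)$ does not depend on the choice of the small set of parameters defining $V$, and, if $\dim^{\mathrm{cl}}$ is definable, then $\dim^{\mathrm{cl}}$ is a dimension function on $\mathbb M$ and $\mathrm{mat}^{\dim^{\mathrm{cl}}}=\mathrm{cl}$. -/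

import Mathlib

open FirstOrder Cardinal

universe u v w z

namespace ExistMat


/-! ### Matroids (pregeometries) -/

/-- `cl` is a finitary matroid on `M`: a finitary closure operator with the exchange principle. -/
structure IsMatroid {M : Type w} (cl : Set M → Set M) : Prop where
  extension : ∀ X, X ⊆ cl X
  monotonicity : ∀ X Y, X ⊆ Y → cl X ⊆ cl Y
  idempotency : ∀ X, cl (cl X) = cl X
  finitariness : ∀ X, cl X = ⋃₀ {Z | ∃ A : Set M, A ⊆ X ∧ A.Finite ∧ Z = cl A}
  exchange : ∀ (X : Set M) (a c : M), a ∈ cl (X ∪ {c}) → a ∉ cl X → c ∈ cl (X ∪ {a})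

/-- `S` is independent over `B`. -/
def IndepOver {M : Type w} (cl : Set M → Set M) (B S : Set M) : Prop :=
  ∀ a ∈ S, a ∉ cl (B ∪ (S \ {a}))

/-- The rank of the tuple `b` over `A`: the largest cardinality of a set of coordinates of `b` that
is independent over `A`. -/
noncomputable def rk {M : Type w} (cl : Set M → Set M) (A : Set M) {n : ℕ} (b : Fin n → M) : ℕ :=
  sSup {k : ℕ | ∃ S : Set M, S ⊆ Set.range b ∧ IndepOver cl A S ∧ S.ncard = k}

/-- The maximal rank over `A` of a tuple in `V`, with value `-∞ = ⊥` when `V` is empty. -/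
noncomputable def dimOver {M : Type w} (cl : Set M → Set M) (A : Set M) {n : ℕ}
    (V : Set (Fin n → M)) : WithBot ℕ :=
  sSup ((fun b => ((rk cl A b : ℕ) : WithBot ℕ)) '' V)

/-! ### First order structures -/

section Structures

variable (L : FirstOrder.Language.{u, v}) {M : Type w} [L.Structure M]

/-- `a` and `a'` have the same type over `B`. -/
def SameType (B : Set M) (a a' : M) : Prop :=
  ∀ φ : L[[B]].Formula (Fin 1), φ.Realize (fun _ => a) ↔ φ.Realize (fun _ => a')

variable (M) in
/-- `M` is `κ`-saturated: a set of formulas in one variable, with parameters from a set of size less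
than `κ`, that is finitely satisfiable in `M` is realized in `M`. -/
def IsSaturated (κ : Cardinal.{w}) : Prop :=
  ∀ A : Set M, #A < κ → ∀ p : Set (L[[A]].Formula (Fin 1)),
    (∀ q : Set (L[[A]].Formula (Fin 1)), q ⊆ p → q.Finite →
      ∃ a : M, ∀ φ ∈ q, φ.Realize (fun _ => a)) →
    ∃ a : M, ∀ φ ∈ p, φ.Realize (fun _ => a)

variable (M) in
/-- `M` is strongly `κ`-homogeneous: a partial elementary map whose domain has size less than `κ`
extends to an automorphism. -/
def IsStronglyHomogeneous (κ : Cardinal.{w}) : Prop :=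
  ∀ A : Set M, #A < κ → ∀ g : A → M,
    (∀ φ : L.Formula A, φ.Realize (fun a : A => (a : M)) ↔ φ.Realize g) →
    ∃ σ : M ≃[L] M, ∀ a : A, σ a = g a

variable (M) in
/-- `M` is a monster model (of its complete theory `T`) with respect to `κ > |T|`. -/
structure IsMonster (κ : Cardinal.{w}) : Prop where
  card_lt : Cardinal.lift.{w} (max ℵ₀ L.card) < Cardinal.lift.{max u v} κ
  saturated : IsSaturated L M κ
  homogeneous : IsStronglyHomogeneous L M κ

/-! ### Existential matroids -/

/-- The formula `φ(ȳ, x)`, whose last variable is `x`, is `x`-narrow with respect to `cl`. -/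
def IsNarrow (cl : Set M → Set M) {n : ℕ} (φ : L.Formula (Fin (n + 1))) : Prop :=
  ∀ (b : Fin n → M) (a : M), φ.Realize (Fin.snoc b a : Fin (n + 1) → M) → a ∈ cl (Set.range b)

/-- `cl` is definable: it is given by narrow formulas. -/
def IsDefinableClosure (cl : Set M → Set M) : Prop :=
  ∀ A : Set M, cl A = {a | ∃ (n : ℕ) (φ : L.Formula (Fin (n + 1))) (b : Fin n → M),
    IsNarrow L cl φ ∧ (∀ i, b i ∈ A) ∧ φ.Realize (Fin.snoc b a : Fin (n + 1) → M)}

/-- The Existence axiom; `B` and `C` range over the subsets of size less than `κ`. -/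
def HasExistence (κ : Cardinal.{w}) (cl : Set M → Set M) : Prop :=
  ∀ (a : M) (B C : Set M), #B < κ → #C < κ → a ∉ cl B →
    ∃ a' : M, SameType L B a' a ∧ a' ∉ cl (B ∪ C)

/-- `cl` is an existential matroid: a definable matroid that satisfies Existence and is not the
trivial matroid of rank `0`, which sends every set to the whole of `M`. -/
structure IsExistentialMatroid (κ : Cardinal.{w}) (cl : Set M → Set M) : Prop where
  matroid : IsMatroid cl
  definable : IsDefinableClosure L cl
  existence : HasExistence L κ cl
  nontrivial : cl ≠ fun _ => Set.univ

open Classical in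
/-- The dimension induced by `cl` of a definable set `V`: the maximal rank of a tuple in `V` over a
finite set of parameters that defines `V` (for an existential matroid the choice of the parameters
does not matter). -/
noncomputable def matDim (cl : Set M → Set M) {n : ℕ} (V : Set (Fin n → M)) : WithBot ℕ :=
  if h : ∃ A : Finset M, (A : Set M).Definable L V then dimOver cl (h.choose : Set M) V else ⊥

/-- The dimension induced by `cl` is definable. -/
def HasDefinableDim (cl : Set M → Set M) : Prop :=
  ∀ (m n : ℕ) (X : Set (Fin (m + n) → M)), (Set.univ : Set M).Definable L X →
    ∀ k : WithBot ℕ, (Set.univ : Set M).Definable L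
      {a : Fin m → M | matDim L cl {x : Fin n → M | Fin.append a x ∈ X} = k}

/-! ### Dimension functions -/

/-- The set `U(i)` of those `x` whose fibre `U_x` (in the last coordinate) has `d`-value `i`. -/
def fibreSet {M : Type w} (d : ∀ n : ℕ, Set (Fin n → M) → WithBot ℕ) {m : ℕ}
    (U : Set (Fin (m + 1) → M)) (i : ℕ) : Set (Fin m → M) :=
  {x | d 1 {t : Fin 1 → M | (Fin.snoc x (t 0) : Fin (m + 1) → M) ∈ U} = (i : WithBot ℕ)}

/-- `d` is a dimension function on the structure `M`; only its values on the sets definable with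
parameters matter. -/
structure IsDimensionFunction (d : ∀ n : ℕ, Set (Fin n → M) → WithBot ℕ) : Prop where
  eq_bot_iff : ∀ (m : ℕ) (S : Set (Fin m → M)), (Set.univ : Set M).Definable L S →
    (d m S = ⊥ ↔ S = ∅)
  singleton : ∀ a : M, d 1 {fun _ => a} = 0
  line : d 1 Set.univ = 1
  union : ∀ (m : ℕ) (S₁ S₂ : Set (Fin m → M)), (Set.univ : Set M).Definable L S₁ →
    (Set.univ : Set M).Definable L S₂ → d m (S₁ ∪ S₂) = max (d m S₁) (d m S₂)
  perm : ∀ (m : ℕ) (S : Set (Fin m → M)), (Set.univ : Set M).Definable L S →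
    ∀ σ : Equiv.Perm (Fin m), d m {x | x ∘ σ ∈ S} = d m S
  /-- The sets `U(i)` are definable with the same parameters as `U`. -/
  fibre_definable : ∀ (m : ℕ) (A : Set M) (U : Set (Fin (m + 1) → M)), A.Definable L U →
    ∀ i : ℕ, i ≤ 1 → A.Definable L (fibreSet d U i)
  fibre_add : ∀ (m : ℕ) (U : Set (Fin (m + 1) → M)), (Set.univ : Set M).Definable L U →
    ∀ i : ℕ, i ≤ 1 →
      d (m + 1) (U ∩ {y | Fin.init y ∈ fibreSet d U i}) = d m (fibreSet d U i) + (i : WithBot ℕ)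

/-- The operator `mat^d`: `b ∈ mat^d(A)` iff `b` lies in an `A`-definable set of dimension `0`. -/
def matOf (d : ∀ n : ℕ, Set (Fin n → M) → WithBot ℕ) (A : Set M) : Set M :=
  {b | ∃ X : Set (Fin 1 → M), A.Definable L X ∧ d 1 X = 0 ∧ (fun _ => b) ∈ X}

/-- The extension of `mat^d`, where `d` is a dimension function on `K`, to an elementary extension
`M` of `K`: it is given by the formulas `φ(ȳ, x)` without parameters such that `φ(b̄, K)` has
dimension at most `0` for every tuple `b̄` of `K`, evaluated in `M`. -/
def matExt {K : Type z} [L.Structure K] (d : ∀ n : ℕ, Set (Fin n → K) → WithBot ℕ)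
    (M : Type w) [L.Structure M] (A : Set M) : Set M :=
  {a | ∃ (n : ℕ) (φ : L.Formula (Fin (n + 1))) (c : Fin n → M),
    (∀ b : Fin n → K, d 1 {t | φ.Realize (Fin.snoc b (t 0) : Fin (n + 1) → K)} ≤ 0) ∧
    (∀ i, c i ∈ A) ∧ φ.Realize (Fin.snoc c a : Fin (n + 1) → M)}

end Structures

end ExistMat

namespace ExistMat

/-! ### Values in `WithBot ℕ` -/

/-! From matroids to dimensions. Rank is additive along coordinates (`IsMatroid.rk_snoc`). Existence
and strong homogeneity move a tuple by an automorphism fixing the parameters `A` so that its rank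
over any small `B` is at least its old rank over `A` (`IsMonster.exists_aut_rk`); hence the
dimension does not depend on the parameters, and additivity of rank becomes additivity over fibres
(`IsMonster.matDim_fibre_add`). That the sets U(i) need no new parameters is a compactness argument:
smallness of a fibre is witnessed by finitely many narrow formulas, so the set of small fibres is a
union of sets definable over the old parameters. If it is definable at all, finitely many of them
suffice (`IsMonster.definable_matDim_fibre_le_zero`).

From dimensions to matroids. Exchange and transitivity both come from computing the dimension of a
plane set along either coordinate (`IsDimensionFunction.dim_swap_le_zero`,
`IsDimensionFunction.dim_image_le_zero`). These facts about `K` reach `M` through formulas all of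
whose instances in `K` are small (`DSmall`). Since smallness of an instance is definable without
parameters, a formula can be cut down to its small instances (`DSmall.inf_relabel`). For Existence,
suppose that every realization of the type of `a` over `B` is in the closure of `B ∪ C`. By
compactness some formula of that type is contained in a small instance over `B ∪ C`; being contained
in some small instance is expressible over `B`, so `a` was already in the closure of `B`.

The two dimensions agree because the formula that defines the one-dimensional fibres in `K` does so
in `M` (`IsDimensionFunction.matDim_eq_one_iff`), and both dimensions obey the same recursion on the
number of variables (`IsDimensionFunction.exists_dim_formula`). -/

theorem withBot_eq_bot_or_natCast (x : WithBot ℕ) : x = ⊥ ∨ ∃ n : ℕ, x = (n : WithBot ℕ) := by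
  cases x with
  | bot => exact Or.inl rfl
  | coe n => exact Or.inr ⟨n, rfl⟩

/-- Dimensions are maxima, so lower bounds `k ≤ dim` are existential statements; equalities of
dimensions are proved by comparing these. -/
theorem withBot_eq_of_forall_le_iff {x y : WithBot ℕ}
    (h : ∀ k : ℕ, (k : WithBot ℕ) ≤ x ↔ (k : WithBot ℕ) ≤ y) : x = y := by
  apply le_antisymm
  · rcases withBot_eq_bot_or_natCast x with rfl | ⟨n, rfl⟩
    · exact bot_le
    · exact (h n).1 le_rfl
  · rcases withBot_eq_bot_or_natCast y with rfl | ⟨n, rfl⟩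
    · exact bot_le
    · exact (h n).2 le_rfl

theorem not_natCast_le_withBot_bot (k : ℕ) : ¬ (k : WithBot ℕ) ≤ ⊥ := by
  rw [le_bot_iff]
  exact WithBot.natCast_ne_bot k

theorem withBot_le_zero_iff {x : WithBot ℕ} : x ≤ 0 ↔ ¬ ((1 : ℕ) : WithBot ℕ) ≤ x := by
  rcases withBot_eq_bot_or_natCast x with rfl | ⟨n, rfl⟩
  · simp
  · norm_cast
    omega

theorem withBot_le_zero_iff_eq {x : WithBot ℕ} : x ≤ 0 ↔ x = ⊥ ∨ x = 0 := by
  rcases withBot_eq_bot_or_natCast x with rfl | ⟨n, rfl⟩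
  · simp
  · norm_cast
    simp

theorem withBot_eq_zero_iff {x : WithBot ℕ} : x = 0 ↔ x ≤ 0 ∧ x ≠ ⊥ := by
  rw [withBot_le_zero_iff_eq]
  constructor
  · rintro rfl
    exact ⟨Or.inr rfl, by simp⟩
  · rintro ⟨h | h, h'⟩
    · exact absurd h h'
    · exact h

theorem withBot_eq_bot_iff {x : WithBot ℕ} : x = ⊥ ↔ ¬ ((0 : ℕ) : WithBot ℕ) ≤ x := by
  rcases withBot_eq_bot_or_natCast x with rfl | ⟨n, rfl⟩
  · simp
  · simp

theorem withBot_eq_natCast_iff {x : WithBot ℕ} {k : ℕ} :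
    x = k ↔ (k : WithBot ℕ) ≤ x ∧ ¬ ((k + 1 : ℕ) : WithBot ℕ) ≤ x := by
  rcases withBot_eq_bot_or_natCast x with rfl | ⟨n, rfl⟩
  · simp
  · norm_cast
    omega

/-- The truncation in `k - 1` is harmless: at `k = 0` both `0 ≤ y + 1` and `0 ≤ y` say that `y ≠ ⊥`.
-/
theorem natCast_le_withBot_max_iff {k : ℕ} {x y z : WithBot ℕ}
    (h : z = max (x + ((0 : ℕ) : WithBot ℕ)) (y + ((1 : ℕ) : WithBot ℕ))) :
    (k : WithBot ℕ) ≤ z ↔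
      (k : WithBot ℕ) ≤ x ∨ ((k - 1 : ℕ) : WithBot ℕ) ≤ y := by
  subst h
  rw [le_max_iff]
  refine or_congr ?_ ?_
  · simp
  · rcases withBot_eq_bot_or_natCast y with rfl | ⟨n, rfl⟩
    · rw [WithBot.bot_add]
      simp only [not_natCast_le_withBot_bot]
    · norm_cast
      omega

/-! ### Rank -/

section Rank

variable {M : Type w} {cl : Set M → Set M}

/-- The supremum is attained: the empty set is independent, and cardinalities are bounded by that of
`range b`. -/
theorem le_rk_iff {A : Set M} {n : ℕ} {b : Fin n → M} {k : ℕ} :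
    k ≤ rk cl A b ↔ ∃ S ⊆ Set.range b, IndepOver cl A S ∧ k ≤ S.ncard := by
  have hbdd : BddAbove {k : ℕ | ∃ S : Set M, S ⊆ Set.range b ∧ IndepOver cl A S ∧ S.ncard = k} := by
    refine ⟨(Set.range b).ncard, ?_⟩
    rintro k ⟨S, hS, -, rfl⟩
    exact Set.ncard_le_ncard hS (Set.finite_range b)
  constructor
  · intro h
    obtain ⟨S, hS, hi, hk⟩ := Nat.sSup_mem (s := {k : ℕ | ∃ S : Set M, S ⊆ Set.range b ∧
      IndepOver cl A S ∧ S.ncard = k}) ⟨0, ∅, by simp, by simp [IndepOver], by simp⟩ hbdd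
    exact ⟨S, hS, hi, h.trans hk.ge⟩
  · rintro ⟨S, hS, hi, hk⟩
    exact hk.trans (le_csSup hbdd ⟨S, hS, hi, rfl⟩)

theorem rk_le (A : Set M) {n : ℕ} (b : Fin n → M) : rk cl A b ≤ n := by
  obtain ⟨S, hS, -, hk⟩ := le_rk_iff.1 (le_refl (rk cl A b))
  refine hk.trans ((Set.ncard_le_ncard hS (Set.finite_range b)).trans ?_)
  rw [← Set.image_univ]
  exact (Set.ncard_image_le Set.finite_univ).trans (by simp [Set.ncard_univ])

/-- Ranks of `n`-tuples are bounded by `n`, so a nonempty `V` attains its maximum; for empty `V` the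
supremum is `⊥` and both sides fail. -/
theorem le_dimOver_iff {A : Set M} {n : ℕ} {V : Set (Fin n → M)} {k : ℕ} :
    (k : WithBot ℕ) ≤ dimOver cl A V ↔ ∃ b ∈ V, k ≤ rk cl A b := by
  rcases V.eq_empty_or_nonempty with rfl | hV
  · simp [dimOver]
  · obtain ⟨b, hb, hmax⟩ : ∃ b ∈ V, ∀ c ∈ V, rk cl A c ≤ rk cl A b := by
      have hne : (rk cl A '' V).Nonempty := hV.image _
      have hbdd : BddAbove (rk cl A '' V) := ⟨n, by rintro _ ⟨b, -, rfl⟩; exact rk_le A b⟩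
      obtain ⟨b, hb, hb'⟩ := Nat.sSup_mem hne hbdd
      exact ⟨b, hb, fun c hc => by rw [hb']; exact le_csSup hbdd ⟨c, hc, rfl⟩⟩
    have : dimOver cl A V = (rk cl A b : ℕ) := by
      refine IsGreatest.csSup_eq ⟨⟨b, hb, rfl⟩, ?_⟩
      rintro _ ⟨c, hc, rfl⟩
      exact Nat.cast_le.2 (hmax c hc)
    rw [this]
    constructor
    · intro h
      exact ⟨b, hb, by exact_mod_cast h⟩
    · rintro ⟨c, hc, hk⟩
      exact_mod_cast hk.trans (hmax c hc)

theorem dimOver_eq_bot_iff {A : Set M} {n : ℕ} {V : Set (Fin n → M)} :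
    dimOver cl A V = ⊥ ↔ V = ∅ := by
  rw [withBot_eq_bot_iff, le_dimOver_iff, Set.eq_empty_iff_forall_notMem]
  simp

theorem dimOver_union {A : Set M} {n : ℕ} (V W : Set (Fin n → M)) :
    dimOver cl A (V ∪ W) = max (dimOver cl A V) (dimOver cl A W) := by
  refine withBot_eq_of_forall_le_iff fun k => ?_
  rw [le_max_iff, le_dimOver_iff, le_dimOver_iff, le_dimOver_iff]
  simp only [Set.mem_union, or_and_right, exists_or]

theorem IsMatroid.cl_subset (h : IsMatroid cl) {X Y : Set M} (hXY : X ⊆ cl Y) : cl X ⊆ cl Y := by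
  rw [← h.idempotency Y]
  exact h.monotonicity _ _ hXY

theorem IsMatroid.mem_cl (h : IsMatroid cl) {X : Set M} {a : M} (ha : a ∈ X) : a ∈ cl X :=
  h.extension X ha

/-- If adding `t` made some `a ∈ S` dependent, exchange would put `t` in the closure of `A ∪ S`. -/
theorem IsMatroid.indepOver_insert (h : IsMatroid cl) {A S : Set M} {t : M}
    (hS : IndepOver cl A S) (ht : t ∉ cl (A ∪ S)) : IndepOver cl A (insert t S) := by
  have htS : t ∉ S := fun hm => ht (h.mem_cl (Or.inr hm))
  rintro a (rfl | ha) hcl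
  · refine ht (h.monotonicity _ _ ?_ hcl)
    exact Set.union_subset_union_right _ (by simp)
  · have hat : a ≠ t := fun e => htS (e ▸ ha)
    have e1 : A ∪ (insert t S \ {a}) = (A ∪ (S \ {a})) ∪ {t} := by
      rw [Set.insert_sdiff_of_notMem _ (by simpa using hat.symm), Set.union_assoc,
        Set.union_comm _ {t}, Set.singleton_union]
    rw [e1] at hcl
    have := h.exchange _ _ _ hcl (hS a ha)
    refine ht (h.monotonicity _ _ ?_ this)
    rintro x ((hx | hx) | hx)
    · exact Or.inl hx
    · exact Or.inr hx.1
    · rw [Set.mem_singleton_iff] at hx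
      exact Or.inr (hx ▸ ha)

theorem IsMatroid.indepOver_mono (h : IsMatroid cl) {A S T : Set M}
    (hS : IndepOver cl A S) (hTS : T ⊆ S) : IndepOver cl A T := fun a ha hcl =>
  hS a (hTS ha) (h.monotonicity _ _
    (Set.union_subset_union_right _ (Set.sdiff_subset_sdiff_left hTS)) hcl)

theorem IsMatroid.rk_anti (h : IsMatroid cl) {A B : Set M} (hAB : A ⊆ B) {n : ℕ} (b : Fin n → M) :
    rk cl B b ≤ rk cl A b := by
  obtain ⟨S, hS, hi, hk⟩ := le_rk_iff.1 (le_refl (rk cl B b))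
  exact le_rk_iff.2 ⟨S, hS, fun a ha hcl => hi a ha
    (h.monotonicity _ _ (Set.union_subset_union_left _ hAB) hcl), hk⟩

theorem range_snoc {n : ℕ} (x : Fin n → M) (t : M) :
    Set.range (Fin.snoc x t : Fin (n + 1) → M) = insert t (Set.range x) := by
  ext a
  simp only [Set.mem_range, Set.mem_insert_iff, Fin.exists_fin_succ', Fin.snoc_castSucc,
    Fin.snoc_last]
  tauto

-- Additivity of rank, the source of (Dim 4). Since independent sets consist of values of the tuple,
-- a coordinate in the closure of the others must be exchanged out of a maximal independent set.
open Classical in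
theorem IsMatroid.rk_snoc (h : IsMatroid cl) (A : Set M) {n : ℕ} (x : Fin n → M) (t : M) :
    rk cl A (Fin.snoc x t : Fin (n + 1) → M) =
      rk cl A x + if t ∈ cl (A ∪ Set.range x) then 0 else 1 := by
  have hfin : (Set.range (Fin.snoc x t : Fin (n + 1) → M)).Finite := Set.finite_range _
  apply le_antisymm
  · obtain ⟨S, hS, hi, hk⟩ := le_rk_iff.1 (le_refl (rk cl A (Fin.snoc x t : Fin (n + 1) → M)))
    have hSf : S.Finite := hfin.subset hS
    refine hk.trans ?_
    rw [range_snoc] at hS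
    have hSt : S \ {t} ⊆ Set.range x := by
      rintro a ⟨ha, hat⟩
      exact (hS ha).resolve_left hat
    by_cases hts : t ∈ S
    · have hi' := h.indepOver_mono hi (Set.sdiff_subset (t := {t}))
      split_ifs with ht
      -- Some coordinate of `x` can replace `t` in `S`: otherwise `A ∪ (S \ {t})` would generate
      -- `x`, hence `t`, against independence.
      · obtain ⟨y, hy, hy'⟩ : ∃ y ∈ Set.range x, y ∉ cl (A ∪ (S \ {t})) := by
          by_contra! hcon
          refine hi t hts (h.cl_subset (Set.union_subset ?_ hcon) ht)
          exact fun a ha => h.mem_cl (Or.inl ha)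
        have hyS : y ∉ S \ {t} := fun hm => hy' (h.mem_cl (Or.inr hm))
        refine le_rk_iff.2 ⟨insert y (S \ {t}), Set.insert_subset hy hSt,
          h.indepOver_insert hi' hy', ?_⟩
        rw [Set.ncard_insert_of_notMem hyS (hSf.subset Set.sdiff_subset),
          Set.ncard_sdiff_singleton_add_one hts hSf]
      · have : (S \ {t}).ncard ≤ rk cl A x := le_rk_iff.2 ⟨S \ {t}, hSt, hi', le_rfl⟩
        have := Set.ncard_sdiff_singleton_add_one hts hSf
        omega
    · have : S.ncard ≤ rk cl A x := le_rk_iff.2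
        ⟨S, fun a ha => (hS ha).resolve_left (fun e => hts (e ▸ ha)), hi, le_rfl⟩
      omega
  · obtain ⟨S, hS, hi, hk⟩ := le_rk_iff.1 (le_refl (rk cl A x))
    have hSf : S.Finite := (Set.finite_range x).subset hS
    split_ifs with ht
    · exact le_rk_iff.2 ⟨S, by rw [range_snoc]; exact hS.trans (Set.subset_insert _ _), hi, hk⟩
    · have ht' : t ∉ cl (A ∪ S) := fun hm =>
        ht (h.monotonicity _ _ (Set.union_subset_union_right _ hS) hm)
      have htS : t ∉ S := fun hm => ht' (h.mem_cl (Or.inr hm))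
      refine le_rk_iff.2 ⟨insert t S, by rw [range_snoc]; exact Set.insert_subset_insert hS,
        h.indepOver_insert hi ht', ?_⟩
      rw [Set.ncard_insert_of_notMem htS hSf]
      omega

theorem rk_comp_perm (A : Set M) {n : ℕ} (b : Fin n → M) (σ : Equiv.Perm (Fin n)) :
    rk cl A (b ∘ σ) = rk cl A b := by
  unfold rk
  rw [Set.range_comp, σ.surjective.range_eq, Set.image_univ]

theorem rk_fin_zero (A : Set M) (b : Fin 0 → M) : rk cl A b = 0 := Nat.le_zero.1 (rk_le A b)

open Classical in
theorem IsMatroid.rk_one (h : IsMatroid cl) (A : Set M) (t : Fin 1 → M) :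
    rk cl A t = if t 0 ∈ cl A then 0 else 1 := by
  have e : t = (Fin.snoc (Fin.elim0 : Fin 0 → M) (t 0) : Fin 1 → M) := by
    ext i
    rw [Subsingleton.elim i (Fin.last 0), Fin.snoc_last]
    rfl
  have h0 : A ∪ Set.range (Fin.elim0 : Fin 0 → M) = A := by simp [Set.range_eq_empty]
  rw [congrArg (rk cl A) e, h.rk_snoc, rk_fin_zero, h0, zero_add]

theorem IsMatroid.dimOver_one_le_zero_iff (h : IsMatroid cl) {A : Set M} {V : Set (Fin 1 → M)} :
    dimOver cl A V ≤ 0 ↔ ∀ t ∈ V, t 0 ∈ cl A := by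
  rw [withBot_le_zero_iff, le_dimOver_iff]
  push Not
  refine forall₂_congr fun t _ => ?_
  rw [h.rk_one]
  split_ifs with h1 <;> simp [h1]

theorem dimOver_le {A : Set M} {n : ℕ} {V : Set (Fin n → M)} : dimOver cl A V ≤ n := by
  by_contra hc
  have : ((n + 1 : ℕ) : WithBot ℕ) ≤ dimOver cl A V := by
    rcases withBot_eq_bot_or_natCast (dimOver cl A V) with h | ⟨m, h⟩ <;> rw [h] at hc ⊢
    · simp at hc
    · norm_cast at hc ⊢
      omega
  obtain ⟨b, -, hb⟩ := le_dimOver_iff.1 this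
  have := rk_le (cl := cl) A b
  omega

end Rank

/-! ### Formulas, definable sets and compactness -/

theorem exists_finite_image_eq {α β : Type*} {f : α → β} {S : Set α} {H : Set β}
    (hH : H ⊆ f '' S) (hfin : H.Finite) : ∃ T ⊆ S, T.Finite ∧ f '' T = H :=
  Set.exists_subset_image_finite_and (p := fun t => t = H).1 ⟨H, hH, hfin, rfl⟩

section Formulas

open FirstOrder.Language Set

theorem elim_comp_finSumFinEquiv_symm {M : Type w} {m n : ℕ} (x : Fin m → M) (y : Fin n → M) :
    Sum.elim x y ∘ finSumFinEquiv.symm = Fin.append x y := by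
  ext i
  refine Fin.addCases (fun i => ?_) (fun i => ?_) i <;> simp

theorem elim_comp_finSumFinEquiv_symm_const {M : Type w} {m : ℕ} (x : Fin m → M) (a : M) :
    Sum.elim x (fun _ : Fin 1 => a) ∘ finSumFinEquiv.symm = (Fin.snoc x a : Fin (m + 1) → M) := by
  rw [elim_comp_finSumFinEquiv_symm, Fin.append_right_eq_snoc]

theorem snoc_comp_finSumFinEquiv {M : Type w} {m : ℕ} (x : Fin m → M) (a : M) :
    (Fin.snoc x a : Fin (m + 1) → M) ∘ finSumFinEquiv = Sum.elim x (fun _ : Fin 1 => a) := by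
  rw [← elim_comp_finSumFinEquiv_symm_const, Function.comp_assoc]
  simp

variable {L : FirstOrder.Language.{u, v}} {M : Type w} [L.Structure M]

theorem definable_range_of_formula {α β : Type*} (φ : L.Formula (α ⊕ β)) (c : α → M) :
    (range c).Definable L {x : β → M | φ.Realize (Sum.elim c x)} := by
  rw [definable_iff_exists_formula_sum]
  refine ⟨φ.relabel (Sum.map (rangeFactorization c) id), ?_⟩
  ext x
  simp only [mem_ofPred_eq, Formula.realize_relabel, Sum.elim_comp_map, Function.comp_id]
  rfl

theorem definable_preimage_elim {α β : Type*} {A : Set M} {X : Set (α ⊕ β → M)}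
    (hX : A.Definable L X) (c : α → M) :
    (A ∪ range c).Definable L {x : β → M | Sum.elim c x ∈ X} := by
  obtain ⟨φ, rfl⟩ := definable_iff_exists_formula_sum.1 hX
  have := definable_range_of_formula
    (φ.relabel (Equiv.sumAssoc A α β).symm) (Sum.elim (Subtype.val : A → M) c)
  rw [Sum.elim_range, Subtype.range_coe] at this
  convert this using 1
  ext x
  simp only [mem_ofPred_eq, Formula.realize_relabel]
  refine iff_of_eq (congrArg _ ?_)
  ext (i | i | i) <;> rfl

theorem definable_fibre {A : Set M} {m : ℕ} {U : Set (Fin (m + 1) → M)} (hU : A.Definable L U)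
    (x : Fin m → M) :
    (A ∪ range x).Definable L {t : Fin 1 → M | (Fin.snoc x (t 0) : Fin (m + 1) → M) ∈ U} := by
  convert definable_preimage_elim (hU.preimage_comp (finSumFinEquiv (m := m) (n := 1)).symm) x
    using 1
  ext t
  simp only [mem_ofPred_eq, mem_preimage, elim_comp_finSumFinEquiv_symm, Fin.append_right_eq_snoc]

theorem definable_snoc_exists {A : Set M} {m : ℕ} {U : Set (Fin (m + 1) → M)}
    (hU : A.Definable L U) :
    A.Definable L {x : Fin m → M | ∃ t, (Fin.snoc x t : Fin (m + 1) → M) ∈ U} := by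
  convert hU.image_comp (Fin.castSucc (n := m)) using 1
  ext x
  simp only [mem_ofPred_eq, mem_image]
  constructor
  · rintro ⟨t, ht⟩
    exact ⟨_, ht, by ext i; simp⟩
  · rintro ⟨y, hy, rfl⟩
    refine ⟨y (Fin.last m), ?_⟩
    rwa [show (Fin.snoc (y ∘ Fin.castSucc) (y (Fin.last m)) : Fin (m + 1) → M) = y from
      Fin.snoc_init_self y]

theorem definable_sInter {α : Type*} {A : Set M} {G : Set (Set (α → M))} (hG : G.Finite)
    (h : ∀ X ∈ G, A.Definable L X) : A.Definable L (⋂₀ G) := by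
  have := hG.to_subtype
  rw [sInter_eq_iInter]
  exact definable_iInter_of_finite fun X => h X X.2

/-- The number of variables from `α` that occur in `φ`. -/
noncomputable def numVars {α β : Type*} (φ : L.Formula (α ⊕ β)) : ℕ :=
  open Classical in φ.freeVarFinset.toLeft.card

/-- An enumeration of the variables from `α` that occur in `φ`. -/
noncomputable def varEnum {α β : Type*} (φ : L.Formula (α ⊕ β)) (i : Fin (numVars φ)) : α :=
  open Classical in φ.freeVarFinset.toLeft.equivFin.symm i

theorem varEnum_injective {α β : Type*} (φ : L.Formula (α ⊕ β)) :
    Function.Injective (varEnum φ) := by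
  classical
  exact fun i j hij => φ.freeVarFinset.toLeft.equivFin.symm.injective (Subtype.ext hij)

/-- The formula `φ` written with finitely many variables in place of those from `α`. -/
noncomputable def restrictVars {α β : Type*} (φ : L.Formula (α ⊕ β)) :
    L.Formula (Fin (numVars φ) ⊕ β) :=
  open Classical in
  BoundedFormula.restrictFreeVar φ fun x => Sum.casesOn (motive := fun y =>
      y ∈ φ.freeVarFinset → Fin (numVars φ) ⊕ β) x.1
    (fun a ha => Sum.inl (φ.freeVarFinset.toLeft.equivFin ⟨a, by simpa using ha⟩))
    (fun b _ => Sum.inr b) x.2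

/-- Only finitely many variables occur, so a whole parameter set may serve as the index type `α`
while axioms stated for `Fin n` still apply. -/
theorem realize_restrictVars {α β : Type*} (φ : L.Formula (α ⊕ β)) (v : α → M) (x : β → M) :
    (restrictVars φ).Realize (Sum.elim (v ∘ varEnum φ) x) ↔ φ.Realize (Sum.elim v x) := by
  classical
  refine BoundedFormula.realize_restrictFreeVar (Sum.elim v x) ?_
  rintro ⟨a | b, h⟩
  · exact congrArg (fun y : φ.freeVarFinset.toLeft => v y) (Equiv.symm_apply_apply _ _)
  · rfl

theorem Elementary.realize_of_forall {K : Type z} [L.Structure K] (f : K ↪ₑ[L] M) {α : Type*}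
    [Finite α] {φ : L.Formula α} (h : ∀ b : α → K, φ.Realize b) (c : α → M) : φ.Realize c := by
  let ψ : L.Formula Empty := Formula.iAlls α (φ.relabel Sum.inr)
  have h1 : ψ.Realize (Empty.elim : Empty → K) := by
    simp only [ψ, Formula.realize_iAlls, Formula.realize_relabel]
    exact fun i => h i
  have h2 : ψ.Realize (f ∘ (Empty.elim : Empty → K)) := (f.map_formula ψ _).2 h1
  simp only [ψ, Formula.realize_iAlls, Formula.realize_relabel] at h2
  exact h2 c

end Formulas

/-! ### Saturation as compactness for definable sets in several variables -/

section Monster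

open FirstOrder.Language Set

variable {L : FirstOrder.Language.{u, v}} {M : Type w} [L.Structure M] {κ : Cardinal.{w}}

theorem IsMonster.aleph0_lt (hM : IsMonster L M κ) : ℵ₀ < κ := by
  have h := (Cardinal.lift_le.2 (le_max_left ℵ₀ L.card)).trans_lt hM.card_lt
  rw [Cardinal.lift_aleph0] at h
  exact Cardinal.aleph0_lt_lift.1 h

theorem IsMonster.mk_lt_of_finite (hM : IsMonster L M κ) {A : Set M} (hA : A.Finite) : #A < κ :=
  (Cardinal.lt_aleph0_iff_set_finite.2 hA).trans hM.aleph0_lt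

theorem IsMonster.mk_union_lt (hM : IsMonster L M κ) {A B : Set M} (hA : #A < κ) (hB : #B < κ) :
    #(A ∪ B : Set M) < κ :=
  (Cardinal.mk_union_le A B).trans_lt (Cardinal.add_lt_of_lt hM.aleph0_lt.le hA hB)

theorem IsMonster.sInter_nonempty_one (hM : IsMonster L M κ) {A : Set M} (hA : #A < κ)
    (F : Set (Set (Fin 1 → M))) (hF : ∀ X ∈ F, A.Definable L X)
    (hfip : ∀ G ⊆ F, G.Finite → (⋂₀ G).Nonempty) : (⋂₀ F).Nonempty := by
  obtain ⟨a, ha⟩ := hM.saturated A hA {φ | Set.ofPred φ.Realize ∈ F} (by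
    intro q hq hfin
    obtain ⟨t, ht⟩ := hfip ((fun φ => Set.ofPred φ.Realize) '' q)
      (by rintro _ ⟨φ, hφ, rfl⟩; exact hq hφ) (hfin.image _)
    refine ⟨t 0, fun φ hφ => ?_⟩
    have := ht _ ⟨φ, hφ, rfl⟩
    have ht0 : t = fun _ => t 0 := funext fun i => congrArg t (Subsingleton.elim i 0)
    rw [ht0] at this
    exact this)
  refine ⟨fun _ => a, fun X hX => ?_⟩
  obtain ⟨φ, rfl⟩ := hF X hX
  exact ha φ hX

/-- Realization of types in several variables over a small set of parameters. -/
theorem IsMonster.sInter_nonempty (hM : IsMonster L M κ) (n : ℕ) : ∀ {A : Set M} (_ : #A < κ)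
    (F : Set (Set (Fin n → M))) (_ : ∀ X ∈ F, A.Definable L X)
    (_ : ∀ G ⊆ F, G.Finite → (⋂₀ G).Nonempty), (⋂₀ F).Nonempty := by
  induction n with
  | zero =>
    intro A hA F hF hfip
    refine ⟨Fin.elim0, fun X hX => ?_⟩
    obtain ⟨x, hx⟩ := hfip {X} (by simpa using hX) (finite_singleton X)
    rw [sInter_singleton] at hx
    rwa [Subsingleton.elim x Fin.elim0] at hx
  | succ n ih =>
    intro A hA F hF hfip
    -- Projecting the finite intersections, and not just the members of `F`, ensures that the fibres
    -- over the point `x` found below still have the finite intersection property.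
    let P : Set (Set (Fin (n + 1) → M)) → Set (Fin n → M) := fun G =>
      {x | ∃ t, (Fin.snoc x t : Fin (n + 1) → M) ∈ ⋂₀ G}
    obtain ⟨x, hx⟩ := ih hA (P '' {G | G ⊆ F ∧ G.Finite}) (by
      rintro _ ⟨G, ⟨hG, hGf⟩, rfl⟩
      exact definable_snoc_exists (definable_sInter hGf fun X hX => hF X (hG hX))) (by
      intro H hH hHf
      obtain ⟨T, hT, hTf, rfl⟩ := exists_finite_image_eq hH hHf
      obtain ⟨y, hy⟩ := hfip (⋃₀ T) (sUnion_subset fun G hG => (hT hG).1)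
        (hTf.sUnion fun G hG => (hT hG).2)
      refine ⟨Fin.init y, ?_⟩
      rintro _ ⟨G, hG, rfl⟩
      refine ⟨y (Fin.last n), fun X hX => ?_⟩
      rw [Fin.snoc_init_self]
      exact hy X ⟨G, hG, hX⟩)
    let Q : Set (Fin (n + 1) → M) → Set (Fin 1 → M) := fun X =>
      {t | (Fin.snoc x (t 0) : Fin (n + 1) → M) ∈ X}
    obtain ⟨t, ht⟩ := hM.sInter_nonempty_one
      (hM.mk_union_lt hA (hM.mk_lt_of_finite (finite_range x))) (Q '' F)
      (by
        rintro _ ⟨X, hX, rfl⟩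
        exact definable_fibre (hF X hX) x) (by
      intro H hH hHf
      obtain ⟨T, hT, hTf, rfl⟩ := exists_finite_image_eq hH hHf
      obtain ⟨t, ht⟩ := hx _ ⟨T, ⟨hT, hTf⟩, rfl⟩
      refine ⟨fun _ => t, ?_⟩
      rintro _ ⟨X, hX, rfl⟩
      exact ht X hX)
    exact ⟨Fin.snoc x (t 0), fun X hX => ht _ ⟨X, hX, rfl⟩⟩

/-- A definable set covered by sets definable over a small set of parameters is covered by finitely
many of them. -/
theorem IsMonster.exists_finite_cover (hM : IsMonster L M κ) {n : ℕ} {A : Set M} (hA : #A < κ)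
    {X : Set (Fin n → M)} (hX : A.Definable L X) {F : Set (Set (Fin n → M))}
    (hF : ∀ Y ∈ F, A.Definable L Y) (hXF : X ⊆ ⋃₀ F) : ∃ G ⊆ F, G.Finite ∧ X ⊆ ⋃₀ G := by
  by_contra! hcon
  -- The extra `∅` contributes `X` itself, so the common point lies in `X` even when `F` is empty.
  obtain ⟨x, hx⟩ := hM.sInter_nonempty n hA ((fun Y => X \ Y) '' (insert ∅ F))
    (by
      rintro _ ⟨Y, rfl | hY, rfl⟩
      · exact hX.sdiff definable_empty
      · exact hX.sdiff (hF Y hY)) (by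
    intro H hH hHf
    obtain ⟨T, hT, hTf, rfl⟩ := exists_finite_image_eq hH hHf
    have := hcon (T ∩ F) inter_subset_right (hTf.subset inter_subset_left)
    obtain ⟨x, hx, hx'⟩ := not_subset.1 this
    refine ⟨x, ?_⟩
    rintro _ ⟨Y, hY, rfl⟩
    refine ⟨hx, fun hxY => ?_⟩
    rcases hT hY with rfl | hYF
    · exact hxY
    · exact hx' ⟨Y, ⟨hY, hYF⟩, hxY⟩)
  obtain ⟨Y, hY, hxY⟩ := hXF (hx _ ⟨∅, by simp, rfl⟩).1
  exact (hx _ ⟨Y, Or.inr hY, rfl⟩).2 hxY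

end Monster

/-! ### Existential matroids induce dimension functions -/

section Existential

open FirstOrder.Language Set

variable {L : FirstOrder.Language.{u, v}} {M : Type w} [L.Structure M] {κ : Cardinal.{w}}
  {cl : Set M → Set M}

theorem natCast_le_withBot_add_iff {k i : ℕ} {x : WithBot ℕ} :
    (k : WithBot ℕ) ≤ x + (i : WithBot ℕ) ↔ ((k - i : ℕ) : WithBot ℕ) ≤ x := by
  rcases withBot_eq_bot_or_natCast x with rfl | ⟨n, rfl⟩
  · rw [WithBot.bot_add]
    simp only [not_natCast_le_withBot_bot]
  · norm_cast
    omega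

theorem comp_snoc' {N : Type*} (σ : M → N) {n : ℕ} (b : Fin n → M) (a : M) :
    σ ∘ (Fin.snoc b a : Fin (n + 1) → M) = (Fin.snoc (σ ∘ b) (σ a) : Fin (n + 1) → N) :=
  Fin.comp_snoc (α := M) σ b a

theorem IsDefinableClosure.map_mem (h : IsDefinableClosure L cl) (σ : M ≃[L] M) {X : Set M} {a : M}
    (ha : a ∈ cl X) : σ a ∈ cl (σ '' X) := by
  rw [h X] at ha
  obtain ⟨n, φ, b, hn, hb, hφ⟩ := ha
  rw [h]
  refine ⟨n, φ, σ ∘ b, hn, fun i => ⟨b i, hb i, rfl⟩, ?_⟩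
  rw [← comp_snoc', StrongHomClass.realize_formula]
  exact hφ

theorem IsDefinableClosure.map_mem_iff (h : IsDefinableClosure L cl) (σ : M ≃[L] M) {X : Set M}
    {a : M} : σ a ∈ cl (σ '' X) ↔ a ∈ cl X := by
  refine ⟨fun ha => ?_, h.map_mem σ⟩
  have := h.map_mem σ.symm ha
  rwa [← image_comp, σ.symm_apply_apply,
    show σ.symm ∘ σ = id from funext fun x => σ.symm_apply_apply x, image_id] at this

theorem mem_of_fixed {A : Set M} {α : Type*} {V : Set (α → M)} (hV : A.Definable L V)
    (σ : M ≃[L] M) (hσ : ∀ a ∈ A, σ a = a) {x : α → M} (hx : x ∈ V) : σ ∘ x ∈ V := by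
  obtain ⟨φ, rfl⟩ := definable_iff_exists_formula_sum.1 hV
  rw [mem_ofPred_eq] at hx ⊢
  rw [← StrongHomClass.realize_formula σ] at hx
  convert hx using 1
  ext (i | i)
  · exact (hσ i i.2).symm
  · rfl

/-- Existence supplies `a'` of the same type over `B`; homogeneity extends the elementary map fixing
`B` and sending `a` to `a'`. -/
theorem IsMonster.exists_aut (hM : IsMonster L M κ) (h : HasExistence L κ cl)
    {a : M} {B C : Set M} (hB : #B < κ) (hC : #C < κ) (ha : a ∉ cl B) (haB : a ∉ B) :
    ∃ τ : M ≃[L] M, (∀ b ∈ B, τ b = b) ∧ τ a ∉ cl (B ∪ C) := by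
  classical
  obtain ⟨a', hst, ha'⟩ := h a B C hB hC ha
  obtain ⟨τ, hτ⟩ := hM.homogeneous (B ∪ {a})
    (hM.mk_union_lt hB (hM.mk_lt_of_finite (finite_singleton a)))
    (fun x => if (x : M) = a then a' else x) (by
      intro φ
      -- Separating `a` from the elements of `B` turns a formula about `B ∪ {a}` into a one-variable
      -- formula over `B`, to which equality of types applies.
      let e : (B ∪ {a} : Set M) → B ⊕ Fin 1 := fun x =>
        if hx : (x : M) = a then Sum.inr 0 else Sum.inl ⟨x, x.2.resolve_right hx⟩
      obtain ⟨ψ, hψ⟩ : B.Definable L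
          {y : Fin 1 → M | (φ.relabel e).Realize (Sum.elim (Subtype.val : B → M) y)} :=
        definable_iff_exists_formula_sum.2 ⟨φ.relabel e, rfl⟩
      have key : ∀ c : M, ψ.Realize (fun _ => c) ↔
          φ.Realize (Sum.elim (Subtype.val : B → M) (fun _ : Fin 1 => c) ∘ e) := by
        intro c
        rw [← Formula.realize_relabel]
        exact (Set.ext_iff.1 hψ (fun _ => c)).symm
      have := hst ψ
      rw [key, key] at this
      convert this.symm using 2
      · ext x
        by_cases hx : (x : M) = a <;> simp [e, hx]
      · ext x
        by_cases hx : (x : M) = a <;> simp [e, hx])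
  refine ⟨τ, fun b hb => ?_, ?_⟩
  · have := hτ ⟨b, Or.inl hb⟩
    have hba : b ≠ a := fun e => haB (e ▸ hb)
    simpa [hba] using this
  · have := hτ ⟨a, Or.inr rfl⟩
    simp only [if_true] at this
    rwa [this]

/-- By induction on coordinates. A coordinate that is algebraic over `A` and the earlier ones adds
nothing to the left side; any other one is moved out of the closure of `B` and the earlier
coordinates by an automorphism fixing `A` and those coordinates. -/
theorem IsMonster.exists_aut_rk (hM : IsMonster L M κ) (h : IsExistentialMatroid L κ cl)
    {A B : Set M} (hA : #A < κ) (hB : #B < κ) {n : ℕ} (b : Fin n → M) :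
    ∃ σ : M ≃[L] M, (∀ a ∈ A, σ a = a) ∧ rk cl A b ≤ rk cl B (σ ∘ b) := by
  induction n with
  | zero => exact ⟨FirstOrder.Language.Equiv.refl L M, fun a _ => rfl, by simp [rk_fin_zero]⟩
  | succ n ih =>
    obtain ⟨x, t, rfl⟩ : ∃ x t, b = (Fin.snoc x t : Fin (n + 1) → M) :=
      ⟨Fin.init b, b (Fin.last n), (Fin.snoc_init_self b).symm⟩
    obtain ⟨σ, hσA, hσ⟩ := ih x
    by_cases ht : t ∈ cl (A ∪ range x)
    · refine ⟨σ, hσA, ?_⟩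
      rw [comp_snoc', h.matroid.rk_snoc, h.matroid.rk_snoc, if_pos ht]
      omega
    · have hA' : σ '' A = A := by
        rw [image_congr hσA, image_id']
      have ht' : σ t ∉ cl (A ∪ range (σ ∘ x)) := by
        rwa [← h.definable.map_mem_iff σ, image_union, hA', ← range_comp] at ht
      obtain ⟨τ, hτ, hτt⟩ := hM.exists_aut h.existence
        (hM.mk_union_lt hA (hM.mk_lt_of_finite (finite_range (σ ∘ x)))) hB ht'
        (fun hm => ht' (h.matroid.mem_cl hm))
      have hx : τ ∘ σ ∘ x = σ ∘ x := funext fun i => hτ _ (Or.inr ⟨i, rfl⟩)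
      refine ⟨τ.comp σ, fun a ha => ?_, ?_⟩
      · rw [FirstOrder.Language.Equiv.comp_apply, hσA a ha, hτ a (Or.inl ha)]
      · have e : (τ.comp σ) ∘ (Fin.snoc x t : Fin (n + 1) → M) =
            (Fin.snoc (σ ∘ x) (τ (σ t)) : Fin (n + 1) → M) := by
          rw [comp_snoc']
          congr 1
        rw [e, h.matroid.rk_snoc, h.matroid.rk_snoc, if_neg ht, if_neg]
        · omega
        · refine fun hm => hτt (h.matroid.monotonicity _ _ ?_ hm)
          rintro y (hy | hy)
          · exact Or.inr hy
          · exact Or.inl (Or.inr hy)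

/-- More parameters can only lower ranks; conversely the automorphism of `IsMonster.exists_aut_rk`
fixes `A`, so it keeps the tuple in `V`. -/
theorem IsMonster.dimOver_eq_of_subset (hM : IsMonster L M κ) (h : IsExistentialMatroid L κ cl)
    {A B : Set M} (hA : #A < κ) (hB : #B < κ) (hAB : A ⊆ B) {n : ℕ} {V : Set (Fin n → M)}
    (hV : A.Definable L V) : dimOver cl B V = dimOver cl A V := by
  refine withBot_eq_of_forall_le_iff fun k => ?_
  rw [le_dimOver_iff, le_dimOver_iff]
  constructor
  · rintro ⟨b, hb, hk⟩
    exact ⟨b, hb, hk.trans (h.matroid.rk_anti hAB b)⟩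
  · rintro ⟨b, hb, hk⟩
    obtain ⟨σ, hσA, hσ⟩ := hM.exists_aut_rk h hA hB b
    exact ⟨σ ∘ b, mem_of_fixed hV σ hσA hb, hk.trans hσ⟩

theorem IsMonster.matDim_eq (hM : IsMonster L M κ) (h : IsExistentialMatroid L κ cl)
    {n : ℕ} {V : Set (Fin n → M)} {A : Set M} (hA : #A < κ) (hV : A.Definable L V) :
    matDim L cl V = dimOver cl A V := by
  have hex : ∃ A : Finset M, (A : Set M).Definable L V := by
    obtain ⟨A0, -, h0⟩ := definable_iff_finitely_definable.1 hV
    exact ⟨A0, h0⟩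
  rw [matDim, dif_pos hex]
  have hB := hM.mk_lt_of_finite (hex.choose.finite_toSet)
  -- Both `A` and the chosen finite set are compared with their union.
  rw [← hM.dimOver_eq_of_subset h hA (hM.mk_union_lt hA hB) subset_union_left hV,
    ← hM.dimOver_eq_of_subset h hB (hM.mk_union_lt hA hB) subset_union_right hex.choose_spec]

theorem exists_finite_definable {α : Type*} {V : Set (α → M)}
    (hV : (univ : Set M).Definable L V) : ∃ A : Set M, A.Finite ∧ A.Definable L V := by
  obtain ⟨A0, -, h0⟩ := definable_iff_finitely_definable.1 hV
  exact ⟨A0, A0.finite_toSet, h0⟩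

theorem IsDefinableClosure.exists_narrow (hm : IsMatroid cl) (h : IsDefinableClosure L cl)
    {α : Type*} {c : α → M} {a : M} (ha : a ∈ cl (range c)) :
    ∃ φ : L.Formula (α ⊕ Fin 1),
      (∀ (c' : α → M) (a' : M), φ.Realize (Sum.elim c' fun _ => a') → a' ∈ cl (range c')) ∧
      φ.Realize (Sum.elim c fun _ => a) := by
  rw [h] at ha
  obtain ⟨n, ψ, b, hn, hb, hψ⟩ := ha
  choose g hg using hb
  have key : ∀ (c' : α → M) (a' : M),
      (ψ.relabel (Sum.map g id ∘ finSumFinEquiv.symm)).Realize (Sum.elim c' fun _ => a') ↔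
        ψ.Realize (Fin.snoc (c' ∘ g) a' : Fin (n + 1) → M) := by
    intro c' a'
    rw [Formula.realize_relabel, ← Function.comp_assoc, Sum.elim_comp_map, Function.comp_id,
      elim_comp_finSumFinEquiv_symm_const]
  refine ⟨ψ.relabel (Sum.map g id ∘ finSumFinEquiv.symm), fun c' a' hc' => ?_, ?_⟩
  · exact hm.monotonicity _ _ (range_comp_subset_range _ _) (hn _ _ ((key c' a').1 hc'))
  · rw [key, show c ∘ g = b from funext hg]
    exact hψ

theorem definable_sUnion {α : Type*} {A : Set M} {G : Set (Set (α → M))} (hG : G.Finite)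
    (h : ∀ X ∈ G, A.Definable L X) : A.Definable L (⋃₀ G) := by
  have := hG.to_subtype
  rw [sUnion_eq_iUnion]
  exact definable_iUnion_of_finite fun X => h X X.2

/-- A point of a fibre that is algebraic over the base point lies in a definable set all of whose
fibres are algebraic. -/
theorem IsExistentialMatroid.exists_narrow_set (h : IsExistentialMatroid L κ cl) {A : Set M} {m : ℕ}
    {x : Fin m → M} {t : M} (ht : t ∈ cl (A ∪ range x)) :
    ∃ W : Set (Fin (m + 1) → M), A.Definable L W ∧
      (∀ x' t', (Fin.snoc x' t' : Fin (m + 1) → M) ∈ W → t' ∈ cl (A ∪ range x')) ∧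
      (Fin.snoc x t : Fin (m + 1) → M) ∈ W := by
  have hr : ∀ x' : Fin m → M, range (Sum.elim (Subtype.val : A → M) x') = A ∪ range x' := by
    intro x'
    rw [Sum.elim_range, Subtype.range_coe]
  rw [← hr] at ht
  obtain ⟨φ, hφ, hφt⟩ := h.definable.exists_narrow h.matroid ht
  let e : (A ⊕ Fin m) ⊕ Fin 1 → A ⊕ Fin (m + 1) :=
    Sum.elim (Sum.map id Fin.castSucc) fun _ => Sum.inr (Fin.last m)
  have he : ∀ (x' : Fin m → M) (t' : M),
      Sum.elim (Subtype.val : A → M) (Fin.snoc x' t' : Fin (m + 1) → M) ∘ e =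
        Sum.elim (Sum.elim (Subtype.val : A → M) x') fun _ => t' := by
    intro x' t'
    ext ((i | i) | i) <;> simp [e]
  refine ⟨{y | (φ.relabel e).Realize (Sum.elim (Subtype.val : A → M) y)},
    definable_iff_exists_formula_sum.2 ⟨_, rfl⟩, fun x' t' hm => ?_, ?_⟩
  · rw [mem_ofPred_eq, Formula.realize_relabel, he] at hm
    rw [← hr]
    exact hφ _ _ hm
  · rw [mem_ofPred_eq, Formula.realize_relabel, he]
    exact hφt

/-- Two uses of compactness: inside a small fibre, to cover it by finitely many narrow sets, and on
the base, to pass from a union of `A0`-definable sets to a finite one. The hypothesis `hD`, over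
arbitrary parameters, makes the second possible. -/
theorem IsMonster.definable_matDim_fibre_le_zero (hM : IsMonster L M κ)
    (h : IsExistentialMatroid L κ cl) {m : ℕ} {A : Set M} {U : Set (Fin (m + 1) → M)}
    (hU : A.Definable L U)
    (hD : (univ : Set M).Definable L
      {x : Fin m → M | matDim L cl {t : Fin 1 → M | (Fin.snoc x (t 0) : Fin (m + 1) → M) ∈ U} ≤ 0}) :
    A.Definable L
      {x : Fin m → M | matDim L cl {t : Fin 1 → M | (Fin.snoc x (t 0) : Fin (m + 1) → M) ∈ U} ≤ 0} := by
  obtain ⟨A0, hA0, hU0⟩ := definable_iff_finitely_definable.1 hU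
  obtain ⟨B, hBf, hB⟩ := exists_finite_definable hD
  refine Definable.mono ?_ hA0
  set D := {x : Fin m → M |
    matDim L cl {t : Fin 1 → M | (Fin.snoc x (t 0) : Fin (m + 1) → M) ∈ U} ≤ 0} with hDdef
  have hsmall : ∀ x : Fin m → M, #((A0 : Set M) ∪ range x : Set M) < κ := fun x =>
    hM.mk_lt_of_finite (A0.finite_toSet.union (finite_range x))
  have hmem : ∀ x, x ∈ D ↔ ∀ t, (Fin.snoc x t : Fin (m + 1) → M) ∈ U →
      t ∈ cl ((A0 : Set M) ∪ range x) := by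
    intro x
    rw [hDdef, mem_ofPred_eq, hM.matDim_eq h (hsmall x) (definable_fibre hU0 x),
      h.matroid.dimOver_one_le_zero_iff]
    exact ⟨fun hx t ht => hx (fun _ => t) ht, fun hx t ht => hx (t 0) ht⟩
  obtain ⟨G, hGF, hGf, hDG⟩ := hM.exists_finite_cover
    (hM.mk_lt_of_finite (A0.finite_toSet.union hBf)) (hB.mono subset_union_right)
    (F := {Y | (A0 : Set M).Definable L Y ∧ Y ⊆ D}) (fun Y hY => hY.1.mono subset_union_left) (by
      intro x hx
      let N : Set (Set (Fin (m + 1) → M)) := {W | (A0 : Set M).Definable L W ∧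
        ∀ x' t', (Fin.snoc x' t' : Fin (m + 1) → M) ∈ W → t' ∈ cl ((A0 : Set M) ∪ range x')}
      obtain ⟨G, hG, hGf, hcov⟩ := hM.exists_finite_cover (hsmall x) (definable_fibre hU0 x)
        (F := (fun W => {t : Fin 1 → M | (Fin.snoc x (t 0) : Fin (m + 1) → M) ∈ W}) '' N)
        (by
          rintro _ ⟨W, hW, rfl⟩
          exact definable_fibre hW.1 x) (by
        intro t ht
        obtain ⟨W, h1, h2, h3⟩ := h.exists_narrow_set ((hmem x).1 hx (t 0) ht)
        exact ⟨_, ⟨W, ⟨h1, h2⟩, rfl⟩, h3⟩)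
      obtain ⟨T, hTN, hTf, rfl⟩ := exists_finite_image_eq hG hGf
      have hT : (A0 : Set M).Definable L (⋃₀ T) := definable_sUnion hTf fun W hW => (hTN hW).1
      -- The points whose fibre is covered by the same finitely many narrow sets: an `A0`-definable
      -- neighbourhood of `x` inside `D`.
      refine ⟨{x' | ∃ t, (Fin.snoc x' t : Fin (m + 1) → M) ∈ U \ ⋃₀ T}ᶜ,
        ⟨(definable_snoc_exists (hU0.sdiff hT)).compl, fun x' hx' => ?_⟩, ?_⟩
      · refine (hmem x').2 fun t ht => ?_
        by_contra hcon
        refine hx' ⟨t, ht, ?_⟩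
        rintro ⟨W, hW, hW'⟩
        exact hcon ((hTN hW).2 _ _ hW')
      · rintro ⟨t, ht, ht'⟩
        obtain ⟨_, ⟨W, hW, rfl⟩, hWt⟩ := hcov (show (fun _ => t) ∈ _ from ht)
        exact ht' ⟨W, hW, hWt⟩)
  have : D = ⋃₀ G := hDG.antisymm (sUnion_subset fun Y hY => (hGF hY).2)
  rw [this]
  exact definable_sUnion hGf fun Y hY => (hGF hY).1

/-- Over a common finite parameter set `A`, the rank of `(x, t)` is that of `x` over `A` plus that
of `t` over `A` and `x`. For `x` in U(i) the second term is at most `i` on the fibre, and `i` is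
attained. -/
theorem IsMonster.matDim_fibre_add (hM : IsMonster L M κ) (h : IsExistentialMatroid L κ cl) {m : ℕ}
    {U : Set (Fin (m + 1) → M)} (hU : (univ : Set M).Definable L U) {i : ℕ}
    (hUi : (univ : Set M).Definable L (fibreSet (fun n V => matDim L cl (n := n) V) U i)) :
    matDim L cl (U ∩ {y | Fin.init y ∈ fibreSet (fun n V => matDim L cl (n := n) V) U i}) =
      matDim L cl (fibreSet (fun n V => matDim L cl (n := n) V) U i) + (i : WithBot ℕ) := by
  set D := fibreSet (fun n V => matDim L cl (n := n) V) U i with hDdef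
  obtain ⟨A1, hA1f, hA1⟩ := exists_finite_definable hU
  obtain ⟨A2, hA2f, hA2⟩ := exists_finite_definable hUi
  obtain ⟨A, hAf, hAU, hAD⟩ : ∃ A : Set M, A.Finite ∧ A.Definable L U ∧ A.Definable L D :=
    ⟨A1 ∪ A2, hA1f.union hA2f, hA1.mono subset_union_left, hA2.mono subset_union_right⟩
  have hD' : A.Definable L {y : Fin (m + 1) → M | Fin.init y ∈ D} := hAD.preimage_comp Fin.castSucc
  have hmem : ∀ x ∈ D, dimOver cl (A ∪ range x)
      {t : Fin 1 → M | (Fin.snoc x (t 0) : Fin (m + 1) → M) ∈ U} = i := by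
    intro x hx
    rw [← hM.matDim_eq h (hM.mk_lt_of_finite (hAf.union (finite_range x))) (definable_fibre hAU x)]
    exact hx
  have hrk : ∀ (x : Fin m → M) (t : M), rk cl A (Fin.snoc x t : Fin (m + 1) → M) =
      rk cl A x + rk cl (A ∪ range x) (fun _ : Fin 1 => t) := by
    intro x t
    rw [h.matroid.rk_snoc, h.matroid.rk_one]
  have hκ := hM.mk_lt_of_finite hAf
  rw [hM.matDim_eq h hκ (hAU.inter hD'), hM.matDim_eq h hκ hAD]
  refine withBot_eq_of_forall_le_iff fun k => ?_
  rw [natCast_le_withBot_add_iff, le_dimOver_iff, le_dimOver_iff]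
  constructor
  · rintro ⟨y, ⟨hy, hyD⟩, hk⟩
    refine ⟨Fin.init y, hyD, ?_⟩
    have hy' := Fin.snoc_init_self y
    rw [← hy', hrk] at hk
    have h1 : ((rk cl (A ∪ range (Fin.init y)) (fun _ : Fin 1 => y (Fin.last m)) : ℕ) :
        WithBot ℕ) ≤ i := by
      rw [← hmem _ hyD, le_dimOver_iff]
      exact ⟨fun _ => y (Fin.last m), by rw [mem_ofPred_eq]; exact hy'.symm ▸ hy, le_rfl⟩
    rw [Nat.cast_le] at h1
    omega
  · rintro ⟨x, hx, hk⟩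
    obtain ⟨t, ht, hti⟩ := le_dimOver_iff.1 (hmem x hx).ge
    refine ⟨(Fin.snoc x (t 0) : Fin (m + 1) → M), ⟨ht, ?_⟩, ?_⟩
    · rw [mem_ofPred_eq, Fin.init_snoc]
      exact hx
    · have ht0 : t = fun _ => t 0 := funext fun i => congrArg t (Subsingleton.elim i 0)
      rw [ht0] at hti
      rw [hrk]
      omega

theorem IsMonster.matDim_union (hM : IsMonster L M κ) (h : IsExistentialMatroid L κ cl) {m : ℕ}
    {S₁ S₂ : Set (Fin m → M)} (h₁ : (univ : Set M).Definable L S₁)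
    (h₂ : (univ : Set M).Definable L S₂) :
    matDim L cl (S₁ ∪ S₂) = max (matDim L cl S₁) (matDim L cl S₂) := by
  obtain ⟨A1, hA1f, hA1⟩ := exists_finite_definable h₁
  obtain ⟨A2, hA2f, hA2⟩ := exists_finite_definable h₂
  replace hA1 := hA1.mono (subset_union_left (t := A2))
  replace hA2 := hA2.mono (subset_union_right (s := A1))
  have hκ := hM.mk_lt_of_finite (hA1f.union hA2f)
  rw [hM.matDim_eq h hκ hA1, hM.matDim_eq h hκ hA2, hM.matDim_eq h hκ (hA1.union hA2), dimOver_union]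

theorem IsMonster.matDim_eq_bot_iff (hM : IsMonster L M κ) (h : IsExistentialMatroid L κ cl) {m : ℕ}
    {S : Set (Fin m → M)} (hS : (univ : Set M).Definable L S) : matDim L cl S = ⊥ ↔ S = ∅ := by
  obtain ⟨A, hAf, hA⟩ := exists_finite_definable hS
  rw [hM.matDim_eq h (hM.mk_lt_of_finite hAf) hA, dimOver_eq_bot_iff]

theorem IsMonster.matDim_le (hM : IsMonster L M κ) (h : IsExistentialMatroid L κ cl) {m : ℕ}
    {S : Set (Fin m → M)} (hS : (univ : Set M).Definable L S) : matDim L cl S ≤ m := by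
  obtain ⟨A, hAf, hA⟩ := exists_finite_definable hS
  rw [hM.matDim_eq h (hM.mk_lt_of_finite hAf) hA]
  exact dimOver_le

theorem definable_fibre_univ {m : ℕ} {U : Set (Fin (m + 1) → M)}
    (hU : (univ : Set M).Definable L U) (x : Fin m → M) :
    (univ : Set M).Definable L {t : Fin 1 → M | (Fin.snoc x (t 0) : Fin (m + 1) → M) ∈ U} :=
  (definable_fibre hU x).mono (subset_univ _)

theorem IsMonster.matDim_singleton (hM : IsMonster L M κ) (h : IsExistentialMatroid L κ cl) (a : M) :
    matDim L cl {(fun _ => a : Fin 1 → M)} = 0 := by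
  have hd : ({a} : Set M).Definable L {(fun _ => a : Fin 1 → M)} := by
    have e : {(fun _ => a : Fin 1 → M)} = {x : Fin 1 → M | x 0 ∈ ({a} : Set M)} := by
      ext t
      refine ⟨fun ht => congrFun ht 0, fun ht => funext fun i => ?_⟩
      rw [Subsingleton.elim i 0]
      exact ht
    rw [e]
    exact Definable.singleton L a
  rw [hM.matDim_eq h (hM.mk_lt_of_finite (finite_singleton a)) hd]
  apply le_antisymm
  · rw [h.matroid.dimOver_one_le_zero_iff]
    rintro _ rfl
    exact h.matroid.mem_cl rfl
  · exact le_dimOver_iff.2 ⟨_, rfl, Nat.zero_le _⟩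

theorem IsMonster.matDim_line (hM : IsMonster L M κ) (h : IsExistentialMatroid L κ cl) :
    matDim L cl (univ : Set (Fin 1 → M)) = 1 := by
  apply le_antisymm (hM.matDim_le h definable_univ)
  rw [hM.matDim_eq h (hM.mk_lt_of_finite finite_empty) definable_univ]
  obtain ⟨a, ha⟩ : ∃ a, a ∉ cl ∅ := by
    by_contra! hcon
    exact h.nontrivial (funext fun X => eq_univ_of_forall fun a =>
      h.matroid.monotonicity _ _ (empty_subset X) (hcon a))
  refine le_dimOver_iff.2 ⟨fun _ => a, mem_univ _, ?_⟩
  rw [h.matroid.rk_one, if_neg ha]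

theorem IsMonster.isDimensionFunction_matDim (hM : IsMonster L M κ)
    (h : IsExistentialMatroid L κ cl) (hd : HasDefinableDim L cl) :
    IsDimensionFunction L (fun n V => matDim L cl (n := n) V) := by
  have hfib : ∀ (m : ℕ) (U : Set (Fin (m + 1) → M)), (univ : Set M).Definable L U →
      ∀ k : WithBot ℕ, (univ : Set M).Definable L {x : Fin m → M |
        matDim L cl {t : Fin 1 → M | (Fin.snoc x (t 0) : Fin (m + 1) → M) ∈ U} = k} := by
    intro m U hU k
    simpa only [Fin.append_right_eq_snoc] using hd m 1 U hU k
  refine ⟨fun m S hS => hM.matDim_eq_bot_iff h hS, hM.matDim_singleton h, hM.matDim_line h,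
    fun m S₁ S₂ h₁ h₂ => hM.matDim_union h h₁ h₂, fun m S hS σ => ?_, fun m A U hU i hi => ?_,
    fun m U hU i hi => hM.matDim_fibre_add h hU (hfib m U hU i)⟩
  · obtain ⟨A, hAf, hA⟩ := exists_finite_definable hS
    have hκ := hM.mk_lt_of_finite hAf
    change matDim L cl {x | x ∘ σ ∈ S} = matDim L cl S
    have hA' : A.Definable L {x | x ∘ σ ∈ S} := hA.preimage_comp σ
    rw [hM.matDim_eq h hκ hA, hM.matDim_eq h hκ hA']
    refine withBot_eq_of_forall_le_iff fun k => ?_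
    rw [le_dimOver_iff, le_dimOver_iff]
    constructor
    · rintro ⟨b, hb, hk⟩
      exact ⟨b ∘ σ, hb, by rwa [rk_comp_perm]⟩
    · rintro ⟨b, hb, hk⟩
      refine ⟨b ∘ σ.symm, ?_, by rwa [rk_comp_perm]⟩
      rwa [mem_ofPred_eq, Function.comp_assoc, Equiv.symm_comp_self, Function.comp_id]
  · have hU' := hU.mono (subset_univ A)
    have hfd := fun x => definable_fibre_univ hU' x
    have hD := hM.definable_matDim_fibre_le_zero h hU (by
      convert (hfib m U hU' ⊥).union (hfib m U hU' 0) using 1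
      ext x
      exact withBot_le_zero_iff_eq)
    -- Only the set of fibres of dimension at most `0` needed compactness: U(0) is its intersection
    -- with the projection of `U`, and U(1) is its complement.
    interval_cases i
    · convert hD.inter (definable_snoc_exists hU) using 1
      ext x
      simp only [fibreSet, mem_inter_iff, mem_ofPred_eq, Nat.cast_zero]
      rw [withBot_eq_zero_iff, Ne, hM.matDim_eq_bot_iff h (hfd x), ← Ne, ← nonempty_iff_ne_empty]
      exact and_congr_right fun _ => ⟨fun ⟨t, ht⟩ => ⟨t 0, ht⟩, fun ⟨t, ht⟩ => ⟨fun _ => t, ht⟩⟩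
    · convert hD.compl using 1
      ext x
      simp only [fibreSet, mem_compl_iff, mem_ofPred_eq, withBot_le_zero_iff, not_not]
      exact ⟨fun e => e.ge, fun e => (hM.matDim_le h (hfd x)).antisymm e⟩

theorem IsMonster.matOf_matDim (hM : IsMonster L M κ) (h : IsExistentialMatroid L κ cl) :
    matOf L (fun n V => matDim L cl (n := n) V) = cl := by
  ext A b
  constructor
  · rintro ⟨X, hX, hX0, hb⟩
    obtain ⟨A0, hA0, hX'⟩ := definable_iff_finitely_definable.1 hX
    change matDim L cl X = 0 at hX0
    rw [hM.matDim_eq h (hM.mk_lt_of_finite A0.finite_toSet) hX'] at hX0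
    exact h.matroid.monotonicity _ _ hA0 (h.matroid.dimOver_one_le_zero_iff.1 hX0.le _ hb)
  · intro hb
    rw [h.definable] at hb
    obtain ⟨n, φ, c, hn, hc, hφ⟩ := hb
    have hdef : (range c).Definable L {t : Fin 1 → M | φ.Realize (Fin.snoc c (t 0) : Fin (n + 1) → M)} := by
      convert definable_range_of_formula (φ.relabel (finSumFinEquiv (m := n) (n := 1)).symm) c using 3
      rw [Formula.realize_relabel, elim_comp_finSumFinEquiv_symm, Fin.append_right_eq_snoc]
    have hbm : (fun _ => b) ∈ {t : Fin 1 → M | φ.Realize (Fin.snoc c (t 0) : Fin (n + 1) → M)} := hφ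
    refine ⟨_, hdef.mono (range_subset_iff.2 hc), ?_, hbm⟩
    change matDim L cl _ = 0
    rw [hM.matDim_eq h (hM.mk_lt_of_finite (finite_range c)) hdef]
    apply le_antisymm
    · exact h.matroid.dimOver_one_le_zero_iff.2 fun t ht => hn _ _ ht
    · exact le_dimOver_iff.2 ⟨_, hbm, Nat.zero_le _⟩

end Existential

/-! ### The matroid of a dimension function -/

section DimensionFunction

open FirstOrder.Language Set

variable {L : FirstOrder.Language.{u, v}} {K : Type z} [L.Structure K]
  {d : ∀ n : ℕ, Set (Fin n → K) → WithBot ℕ}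

theorem definable_realize_elim {α β : Type*} (φ : L.Formula (α ⊕ β)) (b : α → K) :
    (univ : Set K).Definable L {t : β → K | φ.Realize (Sum.elim b t)} :=
  (definable_range_of_formula φ b).mono (subset_univ _)

theorem definable_realize {β : Type*} (φ : L.Formula β) :
    (∅ : Set K).Definable L {t : β → K | φ.Realize t} :=
  empty_definable_iff.2 ⟨φ, rfl⟩

theorem IsDimensionFunction.mono (hd : IsDimensionFunction L d) {m : ℕ} {S T : Set (Fin m → K)}
    (hS : (univ : Set K).Definable L S) (hT : (univ : Set K).Definable L T) (hST : S ⊆ T) :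
    d m S ≤ d m T := by
  rw [← union_eq_self_of_subset_left hST, hd.union m S T hS hT]
  exact le_max_left _ _

theorem IsDimensionFunction.le_one (hd : IsDimensionFunction L d) {S : Set (Fin 1 → K)}
    (hS : (univ : Set K).Definable L S) : d 1 S ≤ 1 := by
  rw [← hd.line]
  exact hd.mono hS definable_univ (subset_univ S)

theorem IsDimensionFunction.empty (hd : IsDimensionFunction L d) (m : ℕ) : d m ∅ = ⊥ :=
  (hd.eq_bot_iff m ∅ definable_empty).2 rfl

theorem IsDimensionFunction.nonempty (hd : IsDimensionFunction L d) : Nonempty K := by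
  by_contra hK
  rw [not_nonempty_iff] at hK
  have := hd.line
  rw [eq_empty_of_isEmpty (univ : Set (Fin 1 → K)), hd.empty] at this
  simp at this

theorem withBot_le_zero_of_le_one {x : WithBot ℕ} (h : x ≤ 1) (h' : x ≠ ((1 : ℕ) : WithBot ℕ)) :
    x ≤ 0 := by
  rw [withBot_le_zero_iff]
  exact fun h1 => h' (h.antisymm h1)

theorem withBot_eq_or_of_le_one {x : WithBot ℕ} (h : x ≤ 1) : x = ⊥ ∨ x = 0 ∨ x = 1 := by
  by_cases h1 : x = ((1 : ℕ) : WithBot ℕ)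
  · exact Or.inr (Or.inr h1)
  · rcases withBot_le_zero_iff_eq.1 (withBot_le_zero_of_le_one h h1) with h | h
    · exact Or.inl h
    · exact Or.inr (Or.inl h)

theorem eq_union_fibreSet {m : ℕ} {U : Set (Fin (m + 1) → K)}
    (hbot : ∀ x : Fin m → K, d 1 {t : Fin 1 → K | (Fin.snoc x (t 0) : Fin (m + 1) → K) ∈ U} = ⊥ →
      {t : Fin 1 → K | (Fin.snoc x (t 0) : Fin (m + 1) → K) ∈ U} = ∅)
    (hle : ∀ x : Fin m → K, d 1 {t : Fin 1 → K | (Fin.snoc x (t 0) : Fin (m + 1) → K) ∈ U} ≤ 1) :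
    (U ∩ {y | Fin.init y ∈ fibreSet d U 0}) ∪ (U ∩ {y | Fin.init y ∈ fibreSet d U 1}) = U := by
  rw [← inter_union_distrib_left, inter_eq_left]
  intro y hy
  rcases withBot_eq_or_of_le_one (hle (Fin.init y)) with h | h | h
  · have : (fun _ => y (Fin.last m)) ∈ {t : Fin 1 → K |
        (Fin.snoc (Fin.init y) (t 0) : Fin (m + 1) → K) ∈ U} := by
      rw [mem_ofPred_eq, Fin.snoc_init_self]
      exact hy
    rw [hbot _ h] at this
    exact this.elim
  · exact Or.inl h
  · exact Or.inr h

theorem IsDimensionFunction.fibreSet_definable (hd : IsDimensionFunction L d) {m : ℕ}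
    {U : Set (Fin (m + 1) → K)} (hU : (univ : Set K).Definable L U) {i : ℕ} (hi : i ≤ 1) :
    (univ : Set K).Definable L (fibreSet d U i) :=
  hd.fibre_definable m univ U hU i hi

theorem IsDimensionFunction.fibre_inter_definable (hd : IsDimensionFunction L d) {m : ℕ}
    {U : Set (Fin (m + 1) → K)} (hU : (univ : Set K).Definable L U) {i : ℕ} (hi : i ≤ 1) :
    (univ : Set K).Definable L (U ∩ {y | Fin.init y ∈ fibreSet d U i}) :=
  hU.inter ((hd.fibreSet_definable hU hi).preimage_comp Fin.castSucc)

/-- Nonempty fibres have dimension `0` or `1`, so (Dim 2) and (Dim 4) determine `d` on `m + 1`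
variables from `d` on `m` and on one variable. -/
theorem IsDimensionFunction.eq_max (hd : IsDimensionFunction L d) {m : ℕ}
    {U : Set (Fin (m + 1) → K)} (hU : (univ : Set K).Definable L U) :
    d (m + 1) U = max (d m (fibreSet d U 0) + ((0 : ℕ) : WithBot ℕ))
      (d m (fibreSet d U 1) + ((1 : ℕ) : WithBot ℕ)) := by
  rw [← hd.fibre_add m U hU 0 zero_le_one, ← hd.fibre_add m U hU 1 le_rfl,
    ← hd.union _ _ _ (hd.fibre_inter_definable hU zero_le_one)
      (hd.fibre_inter_definable hU le_rfl), eq_union_fibreSet]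
  · exact fun x hx => (hd.eq_bot_iff 1 _ (definable_fibre_univ hU x)).1 hx
  · exact fun x => hd.le_one (definable_fibre_univ hU x)

theorem IsDimensionFunction.dim_univ_zero (hd : IsDimensionFunction L d) :
    d 0 (univ : Set (Fin 0 → K)) = 0 := by
  -- The axioms fix the value of points only in the line; for the one-point power, the line is
  -- fibred over it and gives `1 = d + 1`.
  have h := hd.fibre_add 0 Set.univ definable_univ 1 le_rfl
  have e : fibreSet d (univ : Set (Fin 1 → K)) 1 = Set.univ :=
    eq_univ_of_forall fun x => hd.line
  rw [e, univ_inter, show {y : Fin 1 → K | Fin.init y ∈ (univ : Set (Fin 0 → K))} = Set.univ from rfl,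
    hd.line] at h
  rcases withBot_eq_bot_or_natCast (d 0 Set.univ) with h0 | ⟨n, h0⟩ <;> rw [h0] at h ⊢
  · simp at h
  · norm_cast at h ⊢
    omega

theorem const_apply_zero {N : Type*} (t : Fin 1 → N) : (fun _ => t 0) = t :=
  funext fun i => congrArg t (Subsingleton.elim 0 i)

/-- If all fibres of a plane set over the first coordinate have dimension at most `0`, then the
transposed set has the dimension of the projection to the first coordinate. -/
theorem IsDimensionFunction.dim_swap_eq (hd : IsDimensionFunction L d) {R : Set (Fin 2 → K)}
    (hR : (univ : Set K).Definable L R)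
    (hfib : ∀ x : Fin 1 → K, d 1 {t : Fin 1 → K | (Fin.snoc x (t 0) : Fin 2 → K) ∈ R} ≤ 0) :
    d 2 {w | w ∘ Equiv.swap 0 1 ∈ R} =
      d 1 {x : Fin 1 → K | ∃ t, (Fin.snoc x t : Fin 2 → K) ∈ R} := by
  have h1 : fibreSet d R 1 = ∅ := by
    refine eq_empty_of_forall_notMem fun x hx => ?_
    have hx' : d 1 {t : Fin 1 → K | (Fin.snoc x (t 0) : Fin 2 → K) ∈ R} = 1 := hx
    have := hfib x
    rw [hx'] at this
    norm_num at this
  have h0 : fibreSet d R 0 = {x : Fin 1 → K | ∃ t, (Fin.snoc x t : Fin 2 → K) ∈ R} := by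
    ext x
    have hx := hfib x
    have hb := hd.eq_bot_iff 1 _ (definable_fibre_univ hR x)
    change d 1 _ = 0 ↔ _
    rw [withBot_eq_zero_iff, Ne, hb, ← Ne, ← nonempty_iff_ne_empty]
    exact ⟨fun ⟨_, t, ht⟩ => ⟨t 0, ht⟩, fun ⟨t, ht⟩ => ⟨hx, fun _ => t, ht⟩⟩
  rw [hd.perm 2 R hR, hd.eq_max hR, h1, h0, hd.empty, WithBot.bot_add, max_bot_right, Nat.cast_zero,
    add_zero]

theorem snoc_comp_swap {N : Type*} (x : Fin 1 → N) (t : N) :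
    (Fin.snoc x t : Fin 2 → N) ∘ Equiv.swap 0 1 = Fin.snoc (fun _ => t) (x 0) := by
  ext i
  fin_cases i <;> rfl

/-- Computed along the first coordinate, `R` has dimension at most `1`; along the second, a
one-dimensional set of one-dimensional fibres would give `2`. This is what exchange rests on. -/
theorem IsDimensionFunction.dim_swap_le_zero (hd : IsDimensionFunction L d) {R : Set (Fin 2 → K)}
    (hR : (univ : Set K).Definable L R)
    (hfib : ∀ x : Fin 1 → K, d 1 {t : Fin 1 → K | (Fin.snoc x (t 0) : Fin 2 → K) ∈ R} ≤ 0) :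
    d 1 {x : Fin 1 → K | d 1 {t : Fin 1 → K | (Fin.snoc t (x 0) : Fin 2 → K) ∈ R} = 1} ≤ 0 := by
  have hR' : (univ : Set K).Definable L {w | w ∘ Equiv.swap 0 1 ∈ R} := hR.preimage_comp _
  have h := hd.dim_swap_eq hR hfib
  have h1 : d 2 {w | w ∘ Equiv.swap 0 1 ∈ R} ≤ 1 := by
    rw [h]
    exact hd.le_one (definable_snoc_exists hR)
  rw [hd.eq_max hR', max_le_iff] at h1
  have e : fibreSet d {w | w ∘ Equiv.swap 0 1 ∈ R} 1 =
      {x : Fin 1 → K | d 1 {t : Fin 1 → K | (Fin.snoc t (x 0) : Fin 2 → K) ∈ R} = 1} := by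
    simp only [fibreSet, mem_ofPred_eq, snoc_comp_swap, const_apply_zero, Nat.cast_one]
  rw [← e]
  have := h1.2
  rcases withBot_eq_bot_or_natCast (d 1 (fibreSet d {w | w ∘ Equiv.swap 0 1 ∈ R} 1)) with h0 | ⟨n, h0⟩
    <;> rw [h0] at this ⊢
  · exact bot_le
  · norm_cast at this ⊢
    omega

/-- Here `R` has dimension at most `0`, so along the second coordinate no fibre is one-dimensional
and the image lies in the base of the zero-dimensional fibres. This gives transitivity of the
closure. -/
theorem IsDimensionFunction.dim_image_le_zero (hd : IsDimensionFunction L d) {R : Set (Fin 2 → K)}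
    (hR : (univ : Set K).Definable L R)
    (hfib : ∀ x : Fin 1 → K, d 1 {t : Fin 1 → K | (Fin.snoc x (t 0) : Fin 2 → K) ∈ R} ≤ 0)
    (hproj : d 1 {x : Fin 1 → K | ∃ t, (Fin.snoc x t : Fin 2 → K) ∈ R} ≤ 0) :
    d 1 {x : Fin 1 → K | ∃ t : Fin 1 → K, (Fin.snoc t (x 0) : Fin 2 → K) ∈ R} ≤ 0 := by
  have hR' : (univ : Set K).Definable L {w | w ∘ Equiv.swap 0 1 ∈ R} := hR.preimage_comp _
  rw [← hd.dim_swap_eq hR hfib, hd.eq_max hR', max_le_iff] at hproj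
  have h0 := hproj.1
  have h1 : d 1 (fibreSet d {w | w ∘ Equiv.swap 0 1 ∈ R} 1) = ⊥ := by
    have := hproj.2
    rcases withBot_eq_bot_or_natCast (d 1 (fibreSet d {w | w ∘ Equiv.swap 0 1 ∈ R} 1)) with
      h0 | ⟨n, h0⟩ <;> rw [h0] at this ⊢
    norm_cast at this
  rw [hd.eq_bot_iff _ _ (hd.fibreSet_definable hR' le_rfl)] at h1
  rw [Nat.cast_zero, add_zero] at h0
  refine le_trans (hd.mono ?_ (hd.fibreSet_definable hR' zero_le_one) ?_) h0
  · convert definable_snoc_exists hR' using 1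
    ext x
    simp only [mem_ofPred_eq, snoc_comp_swap]
    exact ⟨fun ⟨t, ht⟩ => ⟨t 0, by rwa [const_apply_zero]⟩, fun ⟨t, ht⟩ => ⟨_, ht⟩⟩
  · rintro x ⟨t, ht⟩
    have hd' := definable_fibre_univ hR' x
    rcases withBot_eq_or_of_le_one (hd.le_one hd') with h | h | h
    · rw [hd.eq_bot_iff _ _ hd'] at h
      refine (h.le (show t ∈ _ from ?_)).elim
      rwa [mem_ofPred_eq, mem_ofPred_eq, snoc_comp_swap, const_apply_zero]
    · exact h
    · exact (h1.le (show x ∈ fibreSet d _ 1 from h)).elim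

/-- A formula all of whose instances in `K` have dimension at most `0`. -/
def DSmall (d : ∀ n : ℕ, Set (Fin n → K) → WithBot ℕ) {α : Type*} (φ : L.Formula (α ⊕ Fin 1)) :
    Prop :=
  ∀ b : α → K, d 1 {t : Fin 1 → K | φ.Realize (Sum.elim b t)} ≤ 0

/-- Uses the clause of (Dim 4) on parameters, with the empty parameter set: only a formula without
parameters can be evaluated in `M`. -/
theorem IsDimensionFunction.exists_fibre_formula (hd : IsDimensionFunction L d) {α : Type*}
    (φ : L.Formula (α ⊕ Fin 1)) {i : ℕ} (hi : i ≤ 1) :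
    ∃ χ : L.Formula α, ∀ b : α → K,
      χ.Realize b ↔ d 1 {t : Fin 1 → K | φ.Realize (Sum.elim b t)} = i := by
  obtain ⟨χ, hχ⟩ := empty_definable_iff.1 (hd.fibre_definable (numVars φ) ∅ _
    (definable_realize ((restrictVars φ).relabel finSumFinEquiv)) i hi)
  refine ⟨χ.relabel (varEnum φ), fun b => ?_⟩
  have hb := Set.ext_iff.1 hχ (b ∘ varEnum φ)
  rw [Formula.realize_relabel]
  refine hb.symm.trans ?_
  change d 1 _ = _ ↔ _
  simp only [mem_ofPred_eq, Formula.realize_relabel, snoc_comp_finSumFinEquiv, realize_restrictVars,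
    const_apply_zero]

theorem DSmall.restrictVars (hd : IsDimensionFunction L d) {α : Type*} {φ : L.Formula (α ⊕ Fin 1)}
    (h : DSmall d φ) : DSmall d (restrictVars φ) := by
  have := hd.nonempty
  intro b
  -- Values for the occurring variables extend to all of `α` because `K` is nonempty.
  obtain ⟨c, rfl⟩ : ∃ c : α → K, c ∘ varEnum φ = b :=
    (varEnum_injective φ).surjective_comp_right b
  simpa only [realize_restrictVars] using h c

theorem DSmall.relabel {α β : Type*} {φ : L.Formula (α ⊕ Fin 1)} (h : DSmall d φ) (g : α → β) :
    DSmall d (φ.relabel (Sum.map g id)) := by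
  intro b
  simpa only [Formula.realize_relabel, Sum.elim_comp_map, Function.comp_id] using h (b ∘ g)

theorem DSmall.inf_left (hd : IsDimensionFunction L d) {α : Type*} {φ ψ : L.Formula (α ⊕ Fin 1)}
    (h : DSmall d φ) : DSmall d (φ ⊓ ψ) := fun b =>
  (hd.mono (definable_realize_elim _ b) (definable_realize_elim _ b)
    fun _ ht => (Formula.realize_inf.1 ht).1).trans (h b)

/-- The device for producing small formulas: where the condition `χ` on the parameters fails, the
instance is empty and has dimension `⊥`. -/
theorem DSmall.inf_relabel (hd : IsDimensionFunction L d) {α : Type*} {φ : L.Formula (α ⊕ Fin 1)}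
    {χ : L.Formula α}
    (h : ∀ b : α → K, χ.Realize b → d 1 {t : Fin 1 → K | φ.Realize (Sum.elim b t)} ≤ 0) :
    DSmall d (φ ⊓ χ.relabel Sum.inl) := by
  intro b
  by_cases hb : χ.Realize b
  · refine (hd.mono (definable_realize_elim _ b) (definable_realize_elim φ b) fun t ht => ?_).trans
      (h b hb)
    exact (Formula.realize_inf.1 ht).1
  · convert bot_le
    rw [hd.eq_bot_iff _ _ (definable_realize_elim _ b)]
    refine eq_empty_of_forall_notMem fun t ht => hb ?_
    have := (Formula.realize_inf.1 ht).2
    rwa [Formula.realize_relabel, Sum.elim_comp_inl] at this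

theorem DSmall.sup (hd : IsDimensionFunction L d) {α : Type*} {φ ψ : L.Formula (α ⊕ Fin 1)}
    (h : DSmall d φ) (h' : DSmall d ψ) : DSmall d (φ ⊔ ψ) := by
  intro b
  simp only [Formula.realize_sup]
  have := hd.union 1 _ _ (definable_realize_elim φ b) (definable_realize_elim ψ b)
  refine (this.trans_le ?_)
  exact max_le (h b) (h' b)

theorem DSmall.bot (hd : IsDimensionFunction L d) {α : Type*} :
    DSmall d (⊥ : L.Formula (α ⊕ Fin 1)) := by
  intro b
  have : {t : Fin 1 → K | (⊥ : L.Formula (α ⊕ Fin 1)).Realize (Sum.elim b t)} = ∅ :=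
    eq_empty_of_forall_notMem fun t ht => ht
  rw [this, hd.empty]
  exact bot_le

/-! ### The matroid axioms for the extension of mat^d -/

variable {M : Type w} [L.Structure M]

theorem IsDimensionFunction.mem_matExt_range (hd : IsDimensionFunction L d) {α : Type*} {c : α → M}
    {a : M} : a ∈ matExt L d M (range c) ↔
      ∃ φ : L.Formula (α ⊕ Fin 1), DSmall d φ ∧ φ.Realize (Sum.elim c fun _ => a) := by
  constructor
  · rintro ⟨n, φ, b, hφ, hb, hba⟩
    choose g hg using hb
    have h1 : DSmall d (φ.relabel (finSumFinEquiv (m := n) (n := 1)).symm) := by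
      intro b'
      simpa only [Formula.realize_relabel, elim_comp_finSumFinEquiv_symm, Fin.append_right_eq_snoc]
        using hφ b'
    refine ⟨_, h1.relabel g, ?_⟩
    rw [Formula.realize_relabel, Sum.elim_comp_map, show c ∘ g = b from funext hg,
      Function.comp_id, Formula.realize_relabel, elim_comp_finSumFinEquiv_symm_const]
    exact hba
  · rintro ⟨φ, hφ, hca⟩
    refine ⟨numVars φ, (restrictVars φ).relabel finSumFinEquiv, c ∘ varEnum φ, fun b => ?_,
      fun i => ⟨_, rfl⟩, ?_⟩
    · simpa only [Formula.realize_relabel, snoc_comp_finSumFinEquiv, const_apply_zero] using hφ.restrictVars hd b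
    · rwa [Formula.realize_relabel, snoc_comp_finSumFinEquiv, realize_restrictVars]

theorem IsDimensionFunction.mem_matExt (hd : IsDimensionFunction L d) {A : Set M}
    {a : M} : a ∈ matExt L d M A ↔
      ∃ φ : L.Formula (A ⊕ Fin 1), DSmall d φ ∧
        φ.Realize (Sum.elim (Subtype.val : A → M) fun _ => a) := by
  rw [← hd.mem_matExt_range, Subtype.range_coe]

theorem matExt_mono {A B : Set M} (hAB : A ⊆ B) : matExt L d M A ⊆ matExt L d M B := by
  rintro a ⟨n, φ, c, h1, h2, h3⟩
  exact ⟨n, φ, c, h1, fun i => hAB (h2 i), h3⟩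

theorem matExt_finitary {A : Set M} {a : M} (ha : a ∈ matExt L d M A) :
    ∃ F ⊆ A, F.Finite ∧ a ∈ matExt L d M F := by
  obtain ⟨n, φ, c, h1, h2, h3⟩ := ha
  exact ⟨range c, range_subset_iff.2 h2, finite_range c, n, φ, c, h1, fun i => ⟨i, rfl⟩, h3⟩

theorem IsDimensionFunction.subset_matExt (hd : IsDimensionFunction L d) (A : Set M) :
    A ⊆ matExt L d M A := by
  intro a ha
  rw [hd.mem_matExt]
  refine ⟨(Term.var (Sum.inl ⟨a, ha⟩)).equal (Term.var (Sum.inr 0)), fun b => ?_, ?_⟩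
  · have e : {t : Fin 1 → K | ((Term.var (Sum.inl ⟨a, ha⟩)).equal (Term.var (Sum.inr 0)) :
        L.Formula (A ⊕ Fin 1)).Realize (Sum.elim b t)} = {fun _ => b ⟨a, ha⟩} := by
      ext t
      simp only [mem_ofPred_eq, Formula.realize_equal, Term.realize_var, Sum.elim_inl, Sum.elim_inr,
        mem_singleton_iff]
      refine ⟨fun h => funext fun i => ?_, fun h => by rw [h]⟩
      rw [h, Subsingleton.elim i 0]
    rw [e, hd.singleton]
  · simp

theorem range_elim_const (X : Set M) (c : M) :
    range (Sum.elim (Subtype.val : X → M) (fun _ : Fin 1 => c)) = X ∪ {c} := by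
  rw [Sum.elim_range, Subtype.range_coe, range_const]

/-- The plane set defined by a formula with two distinguished variables. -/
def plane {α : Type*} (φ : L.Formula ((α ⊕ Fin 1) ⊕ Fin 1)) (b : α → K) : Set (Fin 2 → K) :=
  {w | φ.Realize (Sum.elim (Sum.elim b fun _ => w 0) fun _ => w 1)}

theorem definable_plane {α : Type*} (φ : L.Formula ((α ⊕ Fin 1) ⊕ Fin 1)) (b : α → K) :
    (univ : Set K).Definable L (plane φ b) := by
  convert definable_realize_elim (φ.relabel
    (Sum.elim (Sum.elim Sum.inl fun _ => Sum.inr 0) fun _ => Sum.inr 1 :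
      (α ⊕ Fin 1) ⊕ Fin 1 → α ⊕ Fin 2)) b using 1
  ext w
  rw [plane, mem_ofPred_eq, mem_ofPred_eq, Formula.realize_relabel]
  refine iff_of_eq (congrArg _ ?_)
  ext ((i | i) | i) <;> rfl

theorem snoc_mem_plane {α : Type*} {φ : L.Formula ((α ⊕ Fin 1) ⊕ Fin 1)} {b : α → K}
    {x : Fin 1 → K} {t : K} : (Fin.snoc x t : Fin 2 → K) ∈ plane φ b ↔
      φ.Realize (Sum.elim (Sum.elim b x) fun _ => t) := by
  change φ.Realize (Sum.elim (Sum.elim b fun _ => x 0) fun _ => t) ↔ _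
  rw [const_apply_zero]

/-- The exchange of two distinguished variables. -/
def swapVars (α : Type*) : (α ⊕ Fin 1) ⊕ Fin 1 → (α ⊕ Fin 1) ⊕ Fin 1 :=
  Sum.elim (Sum.elim (Sum.inl ∘ Sum.inl) Sum.inr) (Sum.inl ∘ Sum.inr)

theorem elim_comp_swapVars {α N : Type*} (b : α → N) (x y : Fin 1 → N) :
    Sum.elim (Sum.elim b x) y ∘ swapVars α = Sum.elim (Sum.elim b y) x := by
  ext ((i | i) | i) <;> rfl

theorem IsDimensionFunction.matExt_exchange (hd : IsDimensionFunction L d) (X : Set M) (a c : M)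
    (ha : a ∈ matExt L d M (X ∪ {c})) (ha' : a ∉ matExt L d M X) :
    c ∈ matExt L d M (X ∪ {a}) := by
  rw [← range_elim_const, hd.mem_matExt_range] at ha
  obtain ⟨φ, hφ, hca⟩ := ha
  -- `ρ` describes the elements over which `φ`, read in the variable of `c`, is one-dimensional. It
  -- is small, so `a` avoids it, and `φ` restricted by `∼ρ` is small in the variable of `c`.
  obtain ⟨ρ, hρ⟩ := hd.exists_fibre_formula (φ.relabel (swapVars X)) le_rfl
  have hρs : DSmall d ρ := by
    intro b
    have := hd.dim_swap_le_zero (definable_plane φ b) fun x => by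
      simpa only [snoc_mem_plane, const_apply_zero] using hφ (Sum.elim b x)
    simpa only [hρ, Formula.realize_relabel, elim_comp_swapVars, snoc_mem_plane, const_apply_zero,
      Nat.cast_one] using this
  have hna : ¬ ρ.Realize (Sum.elim (Subtype.val : X → M) fun _ => a) := fun h =>
    ha' (hd.mem_matExt.2 ⟨ρ, hρs, h⟩)
  rw [← range_elim_const, hd.mem_matExt_range]
  refine ⟨φ.relabel (swapVars X) ⊓ Formula.relabel Sum.inl (∼ρ),
    DSmall.inf_relabel hd fun b hb => ?_, ?_⟩
  · rw [Formula.realize_not, hρ] at hb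
    exact withBot_le_zero_of_le_one (hd.le_one (definable_realize_elim _ b)) hb
  · rw [Formula.realize_inf, Formula.realize_relabel, Formula.realize_relabel, elim_comp_swapVars,
      Sum.elim_comp_inl, Formula.realize_not]
    exact ⟨hca, hna⟩

theorem IsDimensionFunction.matExt_trans (hd : IsDimensionFunction L d) {X : Set M} {a c : M}
    (hc : c ∈ matExt L d M X) (ha : a ∈ matExt L d M (X ∪ {c})) : a ∈ matExt L d M X := by
  rw [← range_elim_const, hd.mem_matExt_range] at ha
  rw [hd.mem_matExt] at hc ⊢
  obtain ⟨φ, hφ, hca⟩ := ha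
  obtain ⟨ψ, hψ, hψc⟩ := hc
  -- A small family of small sets: `ψ` bounds the base, `φ` the fibres, and quantifying out the base
  -- variable leaves a small formula satisfied by `a`.
  let θ : L.Formula ((X ⊕ Fin 1) ⊕ Fin 1) := φ ⊓ ψ.relabel Sum.inl
  refine ⟨Formula.iExs (Fin 1) (θ.relabel (swapVars X)), fun b => ?_, ?_⟩
  · have := hd.dim_image_le_zero (definable_plane θ b) (fun x => by
      simpa only [snoc_mem_plane, const_apply_zero] using hφ.inf_left hd (Sum.elim b x)) ((hd.mono
        (definable_snoc_exists (definable_plane θ b)) (definable_realize_elim ψ b) ?_).trans (hψ b))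
    · simpa only [Formula.realize_iExs, Formula.realize_relabel, elim_comp_swapVars, snoc_mem_plane,
        const_apply_zero] using this
    · rintro x ⟨t, ht⟩
      rw [snoc_mem_plane, Formula.realize_inf, Formula.realize_relabel, Sum.elim_comp_inl] at ht
      exact ht.2
  · rw [Formula.realize_iExs]
    refine ⟨fun _ => c, ?_⟩
    rw [Formula.realize_relabel, elim_comp_swapVars, Formula.realize_inf, Formula.realize_relabel,
      Sum.elim_comp_inl]
    exact ⟨hca, hψc⟩

theorem IsDimensionFunction.matExt_idem (hd : IsDimensionFunction L d) (X : Set M) :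
    matExt L d M (matExt L d M X) = matExt L d M X := by
  refine Subset.antisymm (fun a ha => ?_) (hd.subset_matExt _)
  obtain ⟨F, hF, hFf, haF⟩ := matExt_finitary ha
  -- By finitariness it is enough to discard finitely many algebraic elements, one at a time.
  have key : ∀ F : Set M, F.Finite → F ⊆ matExt L d M X → matExt L d M (X ∪ F) ⊆ matExt L d M X := by
    intro F hFf
    induction F, hFf using Set.Finite.induction_on with
    | empty => simp
    | @insert c F _ _ ih =>
      intro hF
      have hF' := (subset_insert c F).trans hF
      intro a ha
      refine ih hF' (hd.matExt_trans (c := c) (matExt_mono subset_union_left (hF (mem_insert c F))) ?_)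
      rwa [union_assoc, union_singleton]
  exact key F hFf hF (matExt_mono subset_union_right haF)

theorem IsDimensionFunction.isMatroid_matExt (hd : IsDimensionFunction L d) :
    IsMatroid (matExt L d M) where
  extension := hd.subset_matExt
  monotonicity _ _ h := matExt_mono h
  idempotency := hd.matExt_idem
  finitariness X := by
    ext a
    constructor
    · intro ha
      obtain ⟨F, hF, hFf, haF⟩ := matExt_finitary ha
      exact ⟨_, ⟨F, hF, hFf, rfl⟩, haF⟩
    · rintro ⟨_, ⟨F, hF, -, rfl⟩, haF⟩
      exact matExt_mono hF haF
  exchange := hd.matExt_exchange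

theorem isDefinableClosure_matExt :
    IsDefinableClosure L (matExt L d M) := by
  intro A
  ext a
  constructor
  · rintro ⟨n, φ, c, h1, h2, h3⟩
    exact ⟨n, φ, c, fun b a' hb => ⟨n, φ, b, h1, fun i => ⟨i, rfl⟩, hb⟩, h2, h3⟩
  · rintro ⟨n, φ, b, h1, h2, h3⟩
    exact matExt_mono (range_subset_iff.2 h2) (h1 b a h3)

theorem IsDimensionFunction.mem_matExt_image_iff (hd : IsDimensionFunction L d) (f : K ↪ₑ[L] M)
    (A : Set K) (b : K) : f b ∈ matExt L d M (f '' A) ↔ b ∈ matOf L d A := by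
  have hr : f '' A = range (f ∘ (Subtype.val : A → K)) := by
    rw [range_comp, Subtype.range_coe]
  have hrel : ∀ φ : L.Formula (A ⊕ Fin 1),
      φ.Realize (Sum.elim (f ∘ (Subtype.val : A → K)) fun _ => f b) ↔
        φ.Realize (Sum.elim (Subtype.val : A → K) fun _ => b) := by
    intro φ
    rw [← f.map_formula, Sum.comp_elim]
    rfl
  rw [hr, hd.mem_matExt_range]
  constructor
  · rintro ⟨φ, hφ, hb⟩
    rw [hrel] at hb
    refine ⟨_, definable_iff_exists_formula_sum.2 ⟨φ, rfl⟩, ?_, hb⟩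
    rw [withBot_eq_zero_iff, Ne, hd.eq_bot_iff _ _ (definable_realize_elim _ _)]
    exact ⟨hφ _, fun h => h.le hb⟩
  · rintro ⟨X, hX, hX0, hb⟩
    obtain ⟨φ, rfl⟩ := definable_iff_exists_formula_sum.1 hX
    -- Only this instance of `φ` is known to have dimension `0`; `χ` removes the others.
    obtain ⟨χ, hχ⟩ := hd.exists_fibre_formula φ zero_le_one
    refine ⟨φ ⊓ χ.relabel Sum.inl, DSmall.inf_relabel hd fun c hc => ((hχ c).1 hc).le, ?_⟩
    rw [hrel, Formula.realize_inf, Formula.realize_relabel, Sum.elim_comp_inl, hχ]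
    exact ⟨hb, hX0⟩

end DimensionFunction

/-! ### The matroid of a dimension function is existential -/

section Extension

open FirstOrder.Language Set

variable {L : FirstOrder.Language.{u, v}} {K : Type z} [L.Structure K]
  {d : ∀ n : ℕ, Set (Fin n → K) → WithBot ℕ} {M : Type w} [L.Structure M] {κ : Cardinal.{w}}

/-- The instances over `c` of the formulas of dimension at most `0`. -/
def dsmallSets (L : FirstOrder.Language.{u, v}) {K : Type z} [L.Structure K]
    (d : ∀ n : ℕ, Set (Fin n → K) → WithBot ℕ) {M : Type w} [L.Structure M] {α : Type*}
    (c : α → M) : Set (Set (Fin 1 → M)) :=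
  {Z | ∃ φ : L.Formula (α ⊕ Fin 1), DSmall d φ ∧ Z = {t | φ.Realize (Sum.elim c t)}}

theorem definable_of_mem_dsmallSets {α : Type*} {c : α → M} {Z : Set (Fin 1 → M)}
    (hZ : Z ∈ dsmallSets L d c) : (range c).Definable L Z := by
  obtain ⟨φ, -, rfl⟩ := hZ
  exact definable_range_of_formula φ c

theorem IsDimensionFunction.mem_matExt_range_iff_sUnion (hd : IsDimensionFunction L d) {α : Type*}
    {c : α → M} {t : Fin 1 → M} :
    t 0 ∈ matExt L d M (range c) ↔ t ∈ ⋃₀ dsmallSets L d c := by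
  rw [hd.mem_matExt_range, const_apply_zero]
  constructor
  · rintro ⟨φ, hφ, ht⟩
    exact ⟨_, ⟨φ, hφ, rfl⟩, ht⟩
  · rintro ⟨_, ⟨φ, hφ, rfl⟩, ht⟩
    exact ⟨φ, hφ, ht⟩

theorem IsDimensionFunction.sUnion_mem_dsmallSets (hd : IsDimensionFunction L d) {α : Type*}
    {c : α → M} {G : Set (Set (Fin 1 → M))} (hG : G.Finite) (hGs : G ⊆ dsmallSets L d c) :
    ⋃₀ G ∈ dsmallSets L d c := by
  induction G, hG using Set.Finite.induction_on with
  | empty =>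
    refine ⟨⊥, DSmall.bot hd, ?_⟩
    rw [sUnion_empty]
    exact (eq_empty_of_forall_notMem fun t ht => ht).symm
  | @insert Z G _ _ ih =>
    obtain ⟨ψ, hψ, hψG⟩ := ih ((subset_insert Z G).trans hGs)
    obtain ⟨φ, hφ, rfl⟩ := hGs (mem_insert Z G)
    refine ⟨φ ⊔ ψ, hφ.sup hd hψ, ?_⟩
    rw [sUnion_insert, hψG]
    ext t
    rw [mem_ofPred_eq, Formula.realize_sup]
    rfl

/-- A definable set that lies in the closure of its parameters lies in a set of dimension at
most `0`. -/
theorem IsDimensionFunction.exists_dsmall_cover (hd : IsDimensionFunction L d)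
    (hM : IsMonster L M κ) {α : Type*} {c : α → M} (hc : #(range c) < κ) {X : Set (Fin 1 → M)}
    (hX : (range c).Definable L X) (hXc : ∀ t ∈ X, t 0 ∈ matExt L d M (range c)) :
    ∃ φ : L.Formula (α ⊕ Fin 1), DSmall d φ ∧ ∀ t ∈ X, φ.Realize (Sum.elim c t) := by
  obtain ⟨G, hG, hGf, hXG⟩ := hM.exists_finite_cover hc hX (F := dsmallSets L d c)
    (fun Z hZ => definable_of_mem_dsmallSets hZ)
    (fun t ht => hd.mem_matExt_range_iff_sUnion.1 (hXc t ht))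
  obtain ⟨φ, hφ, hφG⟩ := hd.sUnion_mem_dsmallSets hGf hG
  exact ⟨φ, hφ, fun t ht => hφG.le (hXG ht)⟩

/-- Otherwise compactness gives one small formula without parameters satisfied by all of `M`, hence
by all of `K`, whose dimension is `1`. -/
theorem IsDimensionFunction.matExt_ne_univ (hd : IsDimensionFunction L d) (hM : IsMonster L M κ)
    (f : K ↪ₑ[L] M) : matExt L d M ≠ fun _ => Set.univ := by
  intro h
  have hr : range (f ∘ (Fin.elim0 : Fin 0 → K)) = ∅ := range_eq_empty _
  obtain ⟨φ, hφ, hφM⟩ := hd.exists_dsmall_cover hM (c := f ∘ (Fin.elim0 : Fin 0 → K))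
    (X := Set.univ) (hM.mk_lt_of_finite (finite_range _)) definable_univ
    (fun t _ => by rw [h]; exact mem_univ _)
  have hK := hφ Fin.elim0
  have : {t : Fin 1 → K | φ.Realize (Sum.elim (Fin.elim0 : Fin 0 → K) t)} = Set.univ := by
    refine eq_univ_of_forall fun t => ?_
    rw [mem_ofPred_eq, ← f.map_formula, Sum.comp_elim]
    exact hφM _ (mem_univ _)
  rw [this, hd.line] at hK
  norm_num at hK

theorem exists_formula_of_not_sameType {B : Set M} {a a' : M} (h : ¬ SameType L B a' a) :
    ∃ Y : Set (Fin 1 → M), B.Definable L Y ∧ (fun _ => a) ∉ Y ∧ (fun _ => a') ∈ Y := by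
  rw [SameType, not_forall] at h
  obtain ⟨φ, hφ⟩ := h
  by_cases h1 : φ.Realize fun _ => a'
  · exact ⟨Set.ofPred φ.Realize, ⟨φ, rfl⟩, fun h2 => hφ (iff_of_true h1 h2), h1⟩
  · refine ⟨(Set.ofPred φ.Realize)ᶜ, Definable.compl ⟨φ, rfl⟩, fun h2 => ?_, h1⟩
    exact hφ (iff_of_false h1 h2)

/-- The formula saying that the instance of `θ` is contained in some instance of `ψ`. -/
noncomputable def coveringFormula {α : Type*} {n : ℕ} (θ : L.Formula (α ⊕ Fin 1))
    (ψ : L.Formula (Fin n ⊕ Fin 1)) : L.Formula α :=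
  Formula.iExs (Fin n) (Formula.iAlls (Fin 1)
    ((θ.relabel (Sum.map Sum.inl id)).imp (ψ.relabel (Sum.map Sum.inr id))))

theorem realize_coveringFormula {α : Type*} {n : ℕ} (θ : L.Formula (α ⊕ Fin 1))
    (ψ : L.Formula (Fin n ⊕ Fin 1)) (b : α → M) : (coveringFormula θ ψ).Realize b ↔
      ∃ e : Fin n → M, ∀ t : Fin 1 → M, θ.Realize (Sum.elim b t) → ψ.Realize (Sum.elim e t) := by
  simp only [coveringFormula, Formula.realize_iExs, Formula.realize_iAlls, Formula.realize_imp,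
    Formula.realize_relabel, Sum.elim_comp_map, Function.comp_id, Sum.elim_comp_inl,
    Sum.elim_comp_inr]

theorem IsDimensionFunction.hasExistence_matExt (hd : IsDimensionFunction L d)
    (hM : IsMonster L M κ) : HasExistence L κ (matExt L d M) := by
  intro a B C hB hC ha
  by_contra! hcon
  let c : (B ∪ C : Set M) → M := Subtype.val
  have hc : range c = B ∪ C := Subtype.range_coe
  -- If Existence fails, `M` is covered by `F` (elements with another type over `B`) and the small
  -- sets over `B ∪ C`. In a finite subcover, the complement of the part from `F` is a `B`-definable
  -- set containing `a` and covered by small sets.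
  let F : Set (Set (Fin 1 → M)) := {Y | B.Definable L Y ∧ (fun _ => a) ∉ Y}
  obtain ⟨G, hG, hGf, hcov⟩ := hM.exists_finite_cover (hM.mk_union_lt hB hC)
    (X := (Set.univ : Set (Fin 1 → M))) definable_univ (F := F ∪ dsmallSets L d c)
    (by
      rintro Y (hY | hY)
      · exact hY.1.mono subset_union_left
      · exact hc ▸ definable_of_mem_dsmallSets hY) (by
      intro t _
      by_cases ht : SameType L B (t 0) a
      · have := hcon _ ht
        rw [← hc] at this
        obtain ⟨Z, hZ, htZ⟩ := hd.mem_matExt_range_iff_sUnion.1 this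
        exact ⟨Z, Or.inr hZ, htZ⟩
      · obtain ⟨Y, h1, h2, h3⟩ := exists_formula_of_not_sameType ht
        rw [const_apply_zero] at h3
        exact ⟨Y, Or.inl ⟨h1, h2⟩, h3⟩)
  have hΘ : B.Definable L (⋃₀ (G ∩ F))ᶜ :=
    (definable_sUnion (hGf.subset inter_subset_left) fun Y hY => hY.2.1).compl
  obtain ⟨ψ, hψ, hψG⟩ := hd.sUnion_mem_dsmallSets (c := c) (G := G ∩ dsmallSets L d c)
    (hGf.subset inter_subset_left) inter_subset_right
  obtain ⟨θ, hθ⟩ := definable_iff_exists_formula_sum.1 hΘ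
  have hθa : θ.Realize (Sum.elim (Subtype.val : B → M) fun _ => a) := by
    refine hθ.le (show (fun _ => a) ∈ (⋃₀ (G ∩ F))ᶜ from ?_)
    rintro ⟨Y, hY, haY⟩
    exact hY.2.2 haY
  have hθψ : ∀ t : Fin 1 → M, θ.Realize (Sum.elim (Subtype.val : B → M) t) →
      ψ.Realize (Sum.elim c t) := by
    intro t ht
    have ht' : t ∉ ⋃₀ (G ∩ F) := hθ.ge ht
    obtain ⟨Y, hY, htY⟩ := hcov (mem_univ t)
    refine hψG.le ⟨Y, ⟨hY, (hG hY).resolve_left fun hYF => ht' ⟨Y, ⟨hY, hYF⟩, htY⟩⟩, htY⟩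
  -- Quantifying out the parameters of `ψ` removes those from `C`: an instance of `θ` inside some
  -- instance of the small `ψ` is small, and this is a condition on parameters in `B` alone.
  refine ha (hd.mem_matExt.2 ⟨θ ⊓ (coveringFormula θ (restrictVars ψ)).relabel Sum.inl,
    DSmall.inf_relabel hd fun b hb => ?_, ?_⟩)
  · obtain ⟨e, he⟩ := (realize_coveringFormula θ _ b).1 hb
    exact (hd.mono (definable_realize_elim θ b) (definable_realize_elim _ e) he).trans
      (hψ.restrictVars hd e)
  · rw [Formula.realize_inf, Formula.realize_relabel, Sum.elim_comp_inl,
      realize_coveringFormula]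
    exact ⟨hθa, c ∘ varEnum ψ, fun t ht => (realize_restrictVars ψ c t).2 (hθψ t ht)⟩

theorem IsDimensionFunction.isExistentialMatroid_matExt (hd : IsDimensionFunction L d)
    (hM : IsMonster L M κ) (f : K ↪ₑ[L] M) : IsExistentialMatroid L κ (matExt L d M) :=
  ⟨hd.isMatroid_matExt, isDefinableClosure_matExt, hd.hasExistence_matExt hM,
    hd.matExt_ne_univ hM f⟩

/-- The formula that defines the fibres of dimension `1` in `K` does so in `M`. -/
theorem IsDimensionFunction.matDim_eq_one_iff (hd : IsDimensionFunction L d)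
    (hM : IsMonster L M κ) (f : K ↪ₑ[L] M) {α : Type*} [Finite α] (φ : L.Formula (α ⊕ Fin 1))
    {ρ : L.Formula α}
    (hρ : ∀ b : α → K, ρ.Realize b ↔ d 1 {t : Fin 1 → K | φ.Realize (Sum.elim b t)} = 1)
    (c : α → M) :
    matDim L (matExt L d M) {t : Fin 1 → M | φ.Realize (Sum.elim c t)} = 1 ↔ ρ.Realize c := by
  have h := hd.isExistentialMatroid_matExt hM f
  have hκ := hM.mk_lt_of_finite (finite_range c)
  have hX := definable_range_of_formula φ c
  have hle := hM.matDim_le h (hX.mono (subset_univ _))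
  have hle0 : ∀ b : α → K, ¬ ρ.Realize b →
      d 1 {t : Fin 1 → K | φ.Realize (Sum.elim b t)} ≤ 0 := fun b hb =>
    withBot_le_zero_of_le_one (hd.le_one (definable_realize_elim φ b)) fun h1 => hb ((hρ b).2 h1)
  constructor
  · intro h1
    by_contra hc
    have hs : DSmall d (φ ⊓ Formula.relabel Sum.inl (∼ρ)) := DSmall.inf_relabel hd fun b hb =>
      hle0 b (Formula.realize_not.1 hb)
    have : matDim L (matExt L d M) {t : Fin 1 → M | φ.Realize (Sum.elim c t)} ≤ 0 := by
      rw [hM.matDim_eq h hκ hX, h.matroid.dimOver_one_le_zero_iff]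
      intro t ht
      rw [hd.mem_matExt_range, const_apply_zero]
      refine ⟨_, hs, ?_⟩
      rw [Formula.realize_inf, Formula.realize_relabel, Sum.elim_comp_inl, Formula.realize_not]
      exact ⟨ht, hc⟩
    rw [h1] at this
    norm_num at this
  · intro hc
    by_contra h1
    have h0 := withBot_le_zero_of_le_one hle h1
    rw [hM.matDim_eq h hκ hX, h.matroid.dimOver_one_le_zero_iff] at h0
    obtain ⟨ψ, hψ, hψc⟩ := hd.exists_dsmall_cover hM hκ hX h0
    -- An instance of `φ` contained in one of the small `ψ` is not one-dimensional; as a formula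
    -- true of all tuples of `K`, this transfers to `M`.
    have key := Elementary.realize_of_forall f
      (φ := (Formula.iAlls (Fin 1) (φ.imp ψ)).imp (∼ρ)) (fun b => by
        rw [Formula.realize_imp, Formula.realize_iAlls, Formula.realize_not]
        intro hb hρb
        have h2 := (hd.mono (definable_realize_elim φ b) (definable_realize_elim ψ b) hb).trans
          (hψ b)
        rw [(hρ b).1 hρb] at h2
        norm_num at h2) c
    rw [Formula.realize_imp, Formula.realize_iAlls, Formula.realize_not] at key
    exact key hψc hc

/-- The recursion of `IsDimensionFunction.eq_max` for the induced dimension. Definability of the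
fibre sets is assumed, so that the lemma can be used to prove that the dimension is definable. -/
theorem eq_max_matDim (hM : IsMonster L M κ) {cl : Set M → Set M}
    (h : IsExistentialMatroid L κ cl) {m : ℕ} {U : Set (Fin (m + 1) → M)}
    (hU : (univ : Set M).Definable L U)
    (h0 : (univ : Set M).Definable L (fibreSet (fun n V => matDim L cl (n := n) V) U 0))
    (h1 : (univ : Set M).Definable L (fibreSet (fun n V => matDim L cl (n := n) V) U 1)) :
    matDim L cl U =
      max (matDim L cl (fibreSet (fun n V => matDim L cl (n := n) V) U 0) + ((0 : ℕ) : WithBot ℕ))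
        (matDim L cl (fibreSet (fun n V => matDim L cl (n := n) V) U 1) +
          ((1 : ℕ) : WithBot ℕ)) := by
  have h0' : (univ : Set M).Definable L
      (U ∩ {y | Fin.init y ∈ fibreSet (fun n V => matDim L cl (n := n) V) U 0}) :=
    hU.inter (h0.preimage_comp Fin.castSucc)
  have h1' : (univ : Set M).Definable L
      (U ∩ {y | Fin.init y ∈ fibreSet (fun n V => matDim L cl (n := n) V) U 1}) :=
    hU.inter (h1.preimage_comp Fin.castSucc)
  rw [← hM.matDim_fibre_add h hU h0, ← hM.matDim_fibre_add h hU h1, ← hM.matDim_union h h0' h1',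
    eq_union_fibreSet]
  · exact fun x hx => (hM.matDim_eq_bot_iff h (definable_fibre_univ hU x)).1 hx
  · exact fun x => hM.matDim_le h (definable_fibre_univ hU x)

theorem withBot_eq_zero_iff_of_le_one {N : Type*} {x : WithBot ℕ} {S : Set N} (hx : x ≤ 1)
    (hb : x = ⊥ ↔ S = ∅) : x = ((0 : ℕ) : WithBot ℕ) ↔ x ≠ 1 ∧ S.Nonempty := by
  rw [nonempty_iff_ne_empty, ne_eq S ∅, ← hb]
  rcases withBot_eq_or_of_le_one hx with rfl | rfl | rfl <;> simp

theorem natCast_le_dim_zero_iff {N : Type*} {k : ℕ} {x : WithBot ℕ} {S : Set (Fin 0 → N)}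
    (hx : x ≤ 0) (hb : x = ⊥ ↔ S = ∅) : (k : WithBot ℕ) ≤ x ↔ k = 0 ∧ Fin.elim0 ∈ S := by
  have hS : Fin.elim0 ∈ S ↔ S ≠ ∅ := by
    rw [← nonempty_iff_ne_empty]
    exact ⟨fun h => ⟨_, h⟩, fun ⟨y, hy⟩ => by rwa [Subsingleton.elim Fin.elim0 y]⟩
  rw [hS, Ne, ← hb]
  rcases withBot_eq_bot_or_natCast x with rfl | ⟨n, rfl⟩
  · simp
  · norm_cast at hx ⊢
    simp
    omega

theorem comp_elim_elim0 {α N : Type*} (b : α → N) :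
    b ∘ Sum.elim id (Fin.elim0 : Fin 0 → α) = Sum.elim b (Fin.elim0 : Fin 0 → N) := by
  ext (i | i)
  · rfl
  · exact i.elim0

/-- The separation of the last of `n + 1` variables. -/
def splitLast (α : Type*) (n : ℕ) : α ⊕ Fin (n + 1) → (α ⊕ Fin n) ⊕ Fin 1 :=
  Sum.elim (Sum.inl ∘ Sum.inl) (Fin.snoc (Sum.inl ∘ Sum.inr) (Sum.inr 0))

theorem elim_comp_splitLast {α N : Type*} {n : ℕ} (b : α → N) (x : Fin n → N) (t : Fin 1 → N) :
    Sum.elim (Sum.elim b x) t ∘ splitLast α n = Sum.elim b (Fin.snoc x (t 0) : Fin (n + 1) → N) := by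
  rw [splitLast, Sum.comp_elim, comp_snoc']
  rfl

/-- The dimension of the instances of a formula is defined by the same formulas in `K` and `M`. -/
theorem IsDimensionFunction.exists_dim_formula (hd : IsDimensionFunction L d)
    (hM : IsMonster L M κ) (f : K ↪ₑ[L] M) (n : ℕ) : ∀ {α : Type*} [Finite α]
    (φ : L.Formula (α ⊕ Fin n)) (k : ℕ), ∃ δ : L.Formula α,
      (∀ b : α → K, δ.Realize b ↔
        (k : WithBot ℕ) ≤ d n {x | φ.Realize (Sum.elim b x)}) ∧
      ∀ c : α → M, δ.Realize c ↔
        (k : WithBot ℕ) ≤ matDim L (matExt L d M) {x : Fin n → M | φ.Realize (Sum.elim c x)} := by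
  have h := hd.isExistentialMatroid_matExt hM f
  induction n with
  | zero =>
    intro α _ φ k
    have hK : ∀ b : α → K, (k : WithBot ℕ) ≤ d 0 {x | φ.Realize (Sum.elim b x)} ↔
        k = 0 ∧ φ.Realize (Sum.elim b Fin.elim0) := by
      intro b
      have hb := definable_realize_elim φ b
      refine natCast_le_dim_zero_iff (S := {x | φ.Realize (Sum.elim b x)}) ?_ (hd.eq_bot_iff 0 _ hb)
      rw [← hd.dim_univ_zero]
      exact hd.mono hb definable_univ (subset_univ _)
    have hM' : ∀ c : α → M, (k : WithBot ℕ) ≤ matDim L (matExt L d M)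
        {x : Fin 0 → M | φ.Realize (Sum.elim c x)} ↔
        k = 0 ∧ φ.Realize (Sum.elim c Fin.elim0) := by
      intro c
      have hc := definable_realize_elim φ c
      exact natCast_le_dim_zero_iff (S := {x | φ.Realize (Sum.elim c x)}) (hM.matDim_le h hc) (hM.matDim_eq_bot_iff h hc)
    by_cases hk : k = 0
    · refine ⟨φ.relabel (Sum.elim id Fin.elim0), fun b => ?_, fun c => ?_⟩
      · rw [hK, Formula.realize_relabel, comp_elim_elim0, and_iff_right hk]
      · rw [hM', Formula.realize_relabel, comp_elim_elim0, and_iff_right hk]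
    · refine ⟨⊥, fun b => ?_, fun c => ?_⟩
      · rw [hK]
        exact ⟨fun hb => hb.elim, fun hb => hk hb.1⟩
      · rw [hM']
        exact ⟨fun hb => hb.elim, fun hb => hk hb.1⟩
  | succ n ih =>
    intro α _ φ k
    let φ' := φ.relabel (splitLast α n)
    obtain ⟨ρ₁, hρ₁⟩ := hd.exists_fibre_formula φ' le_rfl
    rw [Nat.cast_one] at hρ₁
    have hρ₁' := hd.matDim_eq_one_iff hM f φ' hρ₁
    -- A fibre on the line has dimension `0` exactly when it is nonempty and not of dimension `1`,
    -- in `K` as in `M`.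
    let ρ₀ : L.Formula (α ⊕ Fin n) := ∼ρ₁ ⊓ Formula.iExs (Fin 1) φ'
    have hK0 : ∀ (b : α → K), fibreSet d {y | φ.Realize (Sum.elim b y)} 0 =
        {x | ρ₀.Realize (Sum.elim b x)} := by
      intro b
      ext x
      have hdef := definable_realize_elim φ' (Sum.elim b x)
      have := withBot_eq_zero_iff_of_le_one (hd.le_one hdef) (hd.eq_bot_iff 1 _ hdef)
      rw [Ne, ← hρ₁] at this
      rw [mem_ofPred_eq, Formula.realize_inf, Formula.realize_not, Formula.realize_iExs]
      refine Iff.trans ?_ this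
      simp only [φ', fibreSet, mem_ofPred_eq, Formula.realize_relabel, elim_comp_splitLast]
    have hK1 : ∀ (b : α → K), fibreSet d {y | φ.Realize (Sum.elim b y)} 1 =
        {x | ρ₁.Realize (Sum.elim b x)} := by
      intro b
      ext x
      rw [mem_ofPred_eq, hρ₁]
      simp only [φ', fibreSet, mem_ofPred_eq, Formula.realize_relabel, elim_comp_splitLast,
        Nat.cast_one]
    have hM0 : ∀ (c : α → M), fibreSet (fun n V => matDim L (matExt L d M) (n := n) V)
        {y | φ.Realize (Sum.elim c y)} 0 = {x | ρ₀.Realize (Sum.elim c x)} := by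
      intro c
      ext x
      have hdef := definable_realize_elim φ' (Sum.elim c x)
      have := withBot_eq_zero_iff_of_le_one (hM.matDim_le h hdef) (hM.matDim_eq_bot_iff h hdef)
      rw [Ne, hρ₁'] at this
      rw [mem_ofPred_eq, Formula.realize_inf, Formula.realize_not, Formula.realize_iExs]
      refine Iff.trans ?_ this
      simp only [φ', fibreSet, mem_ofPred_eq, Formula.realize_relabel, elim_comp_splitLast]
    have hM1 : ∀ (c : α → M), fibreSet (fun n V => matDim L (matExt L d M) (n := n) V)
        {y | φ.Realize (Sum.elim c y)} 1 = {x | ρ₁.Realize (Sum.elim c x)} := by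
      intro c
      ext x
      rw [mem_ofPred_eq, ← hρ₁']
      simp only [φ', fibreSet, mem_ofPred_eq, Formula.realize_relabel, elim_comp_splitLast,
        Nat.cast_one]
    -- Dimension at least `k` means at least `k` on the base of the zero-dimensional fibres or at
    -- least `k - 1` on that of the one-dimensional ones.
    obtain ⟨δ₀, hδ₀, hδ₀'⟩ := ih ρ₀ k
    obtain ⟨δ₁, hδ₁, hδ₁'⟩ := ih ρ₁ (k - 1)
    refine ⟨δ₀ ⊔ δ₁, fun b => ?_, fun c => ?_⟩
    · rw [Formula.realize_sup, hδ₀, hδ₁,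
        natCast_le_withBot_max_iff (hd.eq_max (definable_realize_elim φ b)), hK0, hK1]
    · rw [Formula.realize_sup, hδ₀', hδ₁', natCast_le_withBot_max_iff (eq_max_matDim hM h
        (definable_realize_elim φ c) (by rw [hM0]; exact definable_realize_elim ρ₀ c)
        (by rw [hM1]; exact definable_realize_elim ρ₁ c)), hM0, hM1]

theorem IsDimensionFunction.matDim_matExt (hd : IsDimensionFunction L d) (hM : IsMonster L M κ)
    (f : K ↪ₑ[L] M) (m n : ℕ) (φ : L.Formula (Fin (m + n))) (b : Fin m → K) :
    matDim L (matExt L d M) {x : Fin n → M | φ.Realize (Fin.append (f ∘ b) x)} =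
      d n {x : Fin n → K | φ.Realize (Fin.append b x)} := by
  refine withBot_eq_of_forall_le_iff fun k => ?_
  obtain ⟨δ, hδ, hδ'⟩ := hd.exists_dim_formula hM f n (φ.relabel finSumFinEquiv.symm) k
  simp only [Formula.realize_relabel, elim_comp_finSumFinEquiv_symm] at hδ hδ'
  rw [← hδ, ← hδ', f.map_formula]

theorem IsDimensionFunction.hasDefinableDim_matExt (hd : IsDimensionFunction L d)
    (hM : IsMonster L M κ) (f : K ↪ₑ[L] M) : HasDefinableDim L (matExt L d M) := by
  intro m n X hX k
  obtain ⟨A, hAf, hA⟩ := exists_finite_definable hX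
  have := hAf.to_subtype
  obtain ⟨φ, rfl⟩ := definable_iff_exists_formula_sum.1 hA
  -- The finitely many parameters of `X` become variables, so that the formula without parameters
  -- from `IsDimensionFunction.exists_dim_formula` applies.
  let φ' : L.Formula ((A ⊕ Fin m) ⊕ Fin n) := φ.relabel
    ((Equiv.sumAssoc A (Fin m) (Fin n)).symm ∘ Sum.map id finSumFinEquiv.symm)
  have hφ' : ∀ (a : Fin m → M) (x : Fin n → M),
      φ'.Realize (Sum.elim (Sum.elim (Subtype.val : A → M) a) x) ↔
        φ.Realize (Sum.elim (Subtype.val : A → M) (Fin.append a x)) := by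
    intro a x
    rw [Formula.realize_relabel, ← elim_comp_finSumFinEquiv_symm]
    refine iff_of_eq (congrArg _ ?_)
    ext (i | i)
    · rfl
    · simp only [Function.comp_apply, Sum.map_inr, Sum.elim_inr]
      rcases finSumFinEquiv.symm i with j | j <;> rfl
  have hge : ∀ j : ℕ, (Set.univ : Set M).Definable L {a : Fin m → M | (j : WithBot ℕ) ≤
      matDim L (matExt L d M) {x : Fin n → M | Fin.append a x ∈
        {y | φ.Realize (Sum.elim (Subtype.val : A → M) y)}}} := by
    intro j
    obtain ⟨δ, -, hδ⟩ := hd.exists_dim_formula hM f n φ' j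
    convert definable_realize_elim δ (Subtype.val : A → M) using 1
    ext a
    rw [mem_ofPred_eq, mem_ofPred_eq, hδ]
    simp only [hφ', mem_ofPred_eq]
  rcases withBot_eq_bot_or_natCast k with rfl | ⟨j, rfl⟩
  · convert (hge 0).compl using 1
    ext a
    rw [mem_compl_iff, mem_ofPred_eq, mem_ofPred_eq, withBot_eq_bot_iff]
  · convert (hge j).inter (hge (j + 1)).compl using 1
    ext a
    rw [mem_inter_iff, mem_compl_iff, mem_ofPred_eq, mem_ofPred_eq, mem_ofPred_eq,
      withBot_eq_natCast_iff]

end Extension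

end ExistMat

theorem mainTheorem3 {L : FirstOrder.Language.{u, v}} {M : Type w} [L.Structure M]
    (κ : Cardinal.{w}) (hM : ExistMat.IsMonster L M κ) :
    (∀ (K : Type z) [L.Structure K] (f : K ↪ₑ[L] M)
        (d : ∀ n : ℕ, Set (Fin n → K) → WithBot ℕ),
      ExistMat.IsDimensionFunction L d →
        (∀ (A : Set K) (b : K),
          f b ∈ ExistMat.matExt L d M (f '' A) ↔ b ∈ ExistMat.matOf L d A) ∧
        ExistMat.IsExistentialMatroid L κ (ExistMat.matExt L d M) ∧
        ExistMat.HasDefinableDim L (ExistMat.matExt L d M) ∧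
        (∀ (m n : ℕ) (φ : L.Formula (Fin (m + n))) (b : Fin m → K),
          ExistMat.matDim L (ExistMat.matExt L d M)
              {x : Fin n → M | φ.Realize (Fin.append (f ∘ b) x)} =
            d n {x : Fin n → K | φ.Realize (Fin.append b x)})) ∧
    (∀ cl : Set M → Set M, ExistMat.IsExistentialMatroid L κ cl →
      (∀ (n : ℕ) (V : Set (Fin n → M)) (A : Set M), Cardinal.mk A < κ → A.Definable L V →
        ExistMat.matDim L cl V = ExistMat.dimOver cl A V) ∧
      (ExistMat.HasDefinableDim L cl →
        ExistMat.IsDimensionFunction L (fun n V => ExistMat.matDim L cl (n := n) V) ∧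
        ExistMat.matOf L (fun n V => ExistMat.matDim L cl (n := n) V) = cl)) := by
  refine ⟨fun K _ f d hd => ⟨fun A b => hd.mem_matExt_image_iff f A b,
    hd.isExistentialMatroid_matExt hM f, hd.hasDefinableDim_matExt hM f, hd.matDim_matExt hM f⟩,
    fun cl hcl => ⟨fun n V A hA hV => hM.matDim_eq hcl hA hV, fun hdef =>
      ⟨hM.isDimensionFunction_matDim hcl hdef, hM.matOf_matDim hcl⟩⟩⟩
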